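/- Let $n\ge 2$, let $I\subset\mathbb R$ be open, let $\omega_2:I\to\mathbb C$ be $C^1$ with $\operatorname{Im}\omega_2(t)>0$, put $\omega_1\equiv 1$ and let $\Lambda_t=\mathbb Z+\mathbb Z\omega_2(t)$. Let $f(\cdot,t)$, $t\in I$, be elliptic functions of order $n$ with periods $\omega_1,\omega_2(t)$, each having modulo $\Lambda_t$ a single pole, located at $0$ (hence of order $n$), and only simple critical points; let $f$ be $C^1$ in $(z,t)$ on $\{(z,t): t\in I,\ z\notin\Lambda_t\}$. Let $a_0,\dots,a_n:I\to\mathbb C$ be $C^1$ functions such that $a_0(t),\dots,a_n(t)$ are pairwise incongruent modulo $\Lambda_t$, form a complete set of representatives modulo $\Lambda_t$ of the critical points of $f(\cdot,t)$, and satisfy $\sum_{k=0}^n a_k(t)=0$. Put $A_k(t)=f(a_k(t),t)$ and suppose the normalization $A_0\equiv 0$. Prime denotes $\partial/\partial z$ and dot denotes $d/dt$ or $\partial/\partial t$. Let $$\zeta(z)=\frac1z+\sum_{\omega\in\Lambda_t\setminus\{0\}}\Bigl[\frac1{z-\omega}+\frac1\omega+\frac z{\omega^2}\Bigr],\qquad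 \sigma(z)=z\prod_{\omega\in\Lambda_t\setminus\{0\}}\Bigl(1-\frac z\omega\Bigr)e^{\frac z\omega+\frac{z^2}{2\omega^2}}$$ be the Weierstrass functions of $\Lambda_t$, and let $\eta_1(t)=2\zeta(\omega_1/2)$, $D_k(t)=f''(a_k(t),t)$, $\gamma_k(t)=\dot A_k(t)/D_k(t)$. Then: 1. For every $t\in I$ and every $z\notin\Lambda_t$ with $f'(z,t)\neq0$, $$\frac{\dot f(z,t)}{f'(z,t)}=h(z,t),\qquad h(z,t)=\sum_{j=1}^n\gamma_j(t)\bigl[\zeta(z-a_j(t))+\zeta(a_j(t))-\eta_1(t)z\bigr].$$ 2. There is a function $c:I\to\mathbb C\setminus\{0\}$ such that for every $t\in I$ $$f'(z,t)=c(t)\,\frac{\prod_{k=0}^n\sigma(z-a_k(t))}{\sigma(z)^{n+1}}\quad(z\notin\Lambda_t),\qquad D_k(t)=c(t)\,\frac{\prod_{j\ne k}\sigma(a_k(t)-a_j(t))}{\sigma(a_k(t))^{n+1}}\quad(0\le k\le n).$$ 3. The period $\omega_2$ satisfies $\dot\omega_2(t)=2\pi i\sum_{j=1}^n\gamma_j(t)$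 for every $t\in I$. -/

import Mathlib

noncomputable section

namespace PeriodPair

/-- The Weierstrass zeta function of the lattice of `L`:
`ζ(z) = 1/z + ∑_{ω ≠ 0} (1/(z - ω) + 1/ω + z/ω²)`. -/
def weierstrassZeta (L : PeriodPair) (z : ℂ) : ℂ :=
  1 / z + ∑' l : {l : L.lattice // l ≠ 0},
    (1 / (z - (l.1 : ℂ)) + 1 / (l.1 : ℂ) + z / (l.1 : ℂ) ^ 2)

/-- The Weierstrass sigma function of the lattice of `L`:
`σ(z) = z ∏_{ω ≠ 0} (1 - z/ω) exp(z/ω + z²/(2ω²))`. -/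
def weierstrassSigma (L : PeriodPair) (z : ℂ) : ℂ :=
  z * ∏' l : {l : L.lattice // l ≠ 0},
    ((1 - z / (l.1 : ℂ)) * Complex.exp (z / (l.1 : ℂ) + z ^ 2 / (2 * (l.1 : ℂ) ^ 2)))

/-- The quasi-period `η₁ = 2 ζ(ω₁/2)` of the zeta function. -/
def eta₁ (L : PeriodPair) : ℂ := 2 * L.weierstrassZeta (L.ω₁ / 2)

end PeriodPair

/-- `f t` (`t ∈ I`) is a family of elliptic functions of order `n ≥ 2` with periods `ω₁ = 1` and
`ω₂(t)`, depending smoothly on the real parameter `t`; each has a single pole (modulo periods), at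
the origin, and only simple critical points. The functions `a 0, …, a n` are smooth branches of
the complete set of critical points modulo periods, normalised by `∑ a k = 0` and by the vanishing
of the critical value at `a 0`. The values of `f t` at its poles play no role. -/
structure IsSmoothEllipticFamily (n : ℕ) (I : Set ℝ) (L : ℝ → PeriodPair) (f : ℝ → ℂ → ℂ)
    (a : Fin (n + 1) → ℝ → ℂ) : Prop where
  two_le : 2 ≤ n
  isOpen : IsOpen I
  period_one : ∀ t ∈ I, (L t).ω₁ = 1
  period_two_im_pos : ∀ t ∈ I, 0 < ((L t).ω₂).im
  periodic_one : ∀ t ∈ I, ∀ z, z ∉ (L t).lattice → f t (z + (L t).ω₁) = f t z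
  periodic_two : ∀ t ∈ I, ∀ z, z ∉ (L t).lattice → f t (z + (L t).ω₂) = f t z
  /-- There are no poles outside the lattice. -/
  holomorphic : ∀ t ∈ I, DifferentiableOn ℂ (f t) {z | z ∉ (L t).lattice}
  meromorphicAt_zero : ∀ t ∈ I, MeromorphicAt (f t) 0
  /-- The pole at the origin has order `n`. -/
  order_zero : ∀ t ∈ I, meromorphicOrderAt (f t) 0 = ((-(n : ℤ) : ℤ) : WithTop ℤ)
  smooth_period : ContDiffOn ℝ 1 (fun t => (L t).ω₂) I
  smooth : ContDiffOn ℝ 1 (fun p : ℝ × ℂ => f p.1 p.2) {p | p.1 ∈ I ∧ p.2 ∉ (L p.1).lattice}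
  smooth_crit : ∀ k, ContDiffOn ℝ 1 (a k) I
  crit_notMem : ∀ t ∈ I, ∀ k, a k t ∉ (L t).lattice
  crit : ∀ t ∈ I, ∀ k, deriv (f t) (a k t) = 0
  crit_simple : ∀ t ∈ I, ∀ k, deriv (deriv (f t)) (a k t) ≠ 0
  crit_incongruent : ∀ t ∈ I, ∀ j k, j ≠ k → a j t - a k t ∉ (L t).lattice
  crit_complete : ∀ t ∈ I, ∀ z, z ∉ (L t).lattice → deriv (f t) z = 0 →
    ∃ k, z - a k t ∈ (L t).lattice
  crit_sum : ∀ t ∈ I, ∑ k, a k t = 0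
  critValue_zero : ∀ t ∈ I, f t (a 0 t) = 0

/-- The critical value `A_k(t) = f(a_k(t), t)`. -/
def critValue {n : ℕ} (f : ℝ → ℂ → ℂ) (a : Fin (n + 1) → ℝ → ℂ) (k : Fin (n + 1)) (t : ℝ) : ℂ :=
  f t (a k t)

/-- `D_k(t) = f''(a_k(t), t)`. -/
def critD {n : ℕ} (f : ℝ → ℂ → ℂ) (a : Fin (n + 1) → ℝ → ℂ) (k : Fin (n + 1)) (t : ℝ) : ℂ :=
  deriv (deriv (f t)) (a k t)

/-- `γ_k(t) = Ȧ_k(t) / D_k(t)`. -/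
def critGamma {n : ℕ} (f : ℝ → ℂ → ℂ) (a : Fin (n + 1) → ℝ → ℂ) (k : Fin (n + 1)) (t : ℝ) : ℂ :=
  deriv (critValue f a k) t / critD f a k t

/-- `h(z, t) = ∑_{j=1}^n γ_j(t) (ζ(z - a_j(t)) + ζ(a_j(t)) - η₁(t) z)`; the index `j : Fin n`
stands for the number `j + 1`. -/
def loewnerField {n : ℕ} (L : ℝ → PeriodPair) (f : ℝ → ℂ → ℂ) (a : Fin (n + 1) → ℝ → ℂ)
    (z : ℂ) (t : ℝ) : ℂ :=
  ∑ j : Fin n, critGamma f a j.succ t *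
    ((L t).weierstrassZeta (z - a j.succ t) + (L t).weierstrassZeta (a j.succ t)
      - (L t).eta₁ * z)

end

/-! Fix `t` and consider the defect `ḟ/f' - h` (`loewnerDefect`). It turns out to be entire after
removing singularities. At a critical point `f'` has a simple zero, and the residue of `ḟ/f'` is
`ḟ(a_k)/D_k = γ_k`, because the chain rule along `a_k` loses its `f'` term; `ζ(z - a_k)` has residue
1, and `γ_0 = 0` by the normalization. At the origin `f'` has a pole of order exactly `n + 1` and
`ḟ` one of order at most `n`, so the quotient tends to 0 there, as does `h` since `ζ` is odd.

Differentiating the periodicity of `f` in `t` shows that translation by `mω₁ + kω₂` changes `ḟ/f'`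
by `-k ω̇₂`, and `h` changes by a constant too. The defect is thus entire and additively
quasi-periodic, hence affine by Liouville (`exists_affine_extension`). Its increment over `ω₁` is 0,
so its slope is 0; its value at 0 is 0; and the increment over `ω₂`, rewritten by
`legendre_relation`, must vanish, which is the equation for `ω̇₂`. Claims 1 and 3 therefore come
together in `loewnerDefect_eq_zero`.

For claim 2, `f' σ^{n+1} / ∏ σ(z - a_k)` has removable singularities and is elliptic because `∑ a_k
= 0`; hence it is constant, and differentiating at `a_k` gives `D_k`.

The delicate analytic input is that `C¹` dependence suffices for `ḟ` to be holomorphic with a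
controlled pole: `analyticAt_paramDeriv` and `hasAnalyticExtensionAt_pow_mul_paramDeriv`. -/

open Filter Topology

/-! ### Removable singularities -/

/-- `H` agrees near `z₀`, except possibly at `z₀` itself, with a function analytic at `z₀`. -/
def HasAnalyticExtensionAt (H : ℂ → ℂ) (z₀ : ℂ) : Prop :=
  ∃ g, AnalyticAt ℂ g z₀ ∧ H =ᶠ[𝓝[≠] z₀] g

lemma AnalyticAt.hasAnalyticExtensionAt {H : ℂ → ℂ} {z₀ : ℂ} (h : AnalyticAt ℂ H z₀) :
    HasAnalyticExtensionAt H z₀ := ⟨H, h, .rfl⟩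

namespace HasAnalyticExtensionAt

variable {H K : ℂ → ℂ} {z₀ : ℂ}

lemma congr (h : HasAnalyticExtensionAt H z₀) (e : K =ᶠ[𝓝[≠] z₀] H) :
    HasAnalyticExtensionAt K z₀ :=
  let ⟨g, hg, hH⟩ := h
  ⟨g, hg, e.trans hH⟩

lemma add (hH : HasAnalyticExtensionAt H z₀) (hK : HasAnalyticExtensionAt K z₀) :
    HasAnalyticExtensionAt (fun z ↦ H z + K z) z₀ :=
  let ⟨g, hg, e⟩ := hH
  let ⟨k, hk, e'⟩ := hK
  ⟨fun z ↦ g z + k z, hg.add hk, e.add e'⟩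

lemma sub (hH : HasAnalyticExtensionAt H z₀) (hK : HasAnalyticExtensionAt K z₀) :
    HasAnalyticExtensionAt (fun z ↦ H z - K z) z₀ :=
  let ⟨g, hg, e⟩ := hH
  let ⟨k, hk, e'⟩ := hK
  ⟨fun z ↦ g z - k z, hg.sub hk, e.sub e'⟩

lemma mul (hH : HasAnalyticExtensionAt H z₀) (hK : HasAnalyticExtensionAt K z₀) :
    HasAnalyticExtensionAt (fun z ↦ H z * K z) z₀ :=
  let ⟨g, hg, e⟩ := hH
  let ⟨k, hk, e'⟩ := hK
  ⟨fun z ↦ g z * k z, hg.mul hk, e.mul e'⟩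

end HasAnalyticExtensionAt

lemma tendsto_add_const_punctured_nhds (z₀ l : ℂ) :
    Tendsto (fun z ↦ z + l) (𝓝[≠] z₀) (𝓝[≠] (z₀ + l)) := by
  refine tendsto_nhdsWithin_iff.2 ⟨?_, ?_⟩
  · exact (continuous_id.add continuous_const).continuousAt.tendsto.mono_left nhdsWithin_le_nhds
  · filter_upwards [self_mem_nhdsWithin] with z hz
    simpa using hz

lemma HasAnalyticExtensionAt.of_translate {H : ℂ → ℂ} {z₀ l c : ℂ}
    (h : HasAnalyticExtensionAt H z₀) (e : ∀ᶠ z in 𝓝[≠] z₀, H (z + l) = H z + c) :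
    HasAnalyticExtensionAt H (z₀ + l) := by
  obtain ⟨g, hg, hH⟩ := h
  refine ⟨fun z ↦ g (z - l) + c, ?_, ?_⟩
  · refine AnalyticAt.add ?_ analyticAt_const
    exact AnalyticAt.fun_comp (by simpa using hg) (analyticAt_id.sub analyticAt_const)
  · have := tendsto_add_const_punctured_nhds (z₀ + l) (-l)
    rw [add_neg_cancel_right] at this
    filter_upwards [this.eventually e, this.eventually hH] with z h1 h2
    rw [← sub_eq_add_neg] at h1 h2
    rw [← h2, ← h1, sub_add_cancel]

lemma eq_of_eventuallyEq_punctured_nhds {G K : ℂ → ℂ} {z₀ : ℂ} (hG : ContinuousAt G z₀)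
    (hK : ContinuousAt K z₀) (h : G =ᶠ[𝓝[≠] z₀] K) : G z₀ = K z₀ :=
  tendsto_nhds_unique_of_eventuallyEq (hG.tendsto.mono_left nhdsWithin_le_nhds)
    (hK.tendsto.mono_left nhdsWithin_le_nhds) h

/-- The diagonal `g z z` of the local extensions is entire: near `z₀` it coincides with `g z₀`,
since both values are the limit of `H` through punctured neighbourhoods. -/
lemma exists_entire_extension {H : ℂ → ℂ} (h : ∀ z, HasAnalyticExtensionAt H z) :
    ∃ G : ℂ → ℂ, Differentiable ℂ G ∧ ∀ z, H =ᶠ[𝓝[≠] z] G := by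
  choose g hg hH using h
  have key : ∀ z₀, (fun z ↦ g z z) =ᶠ[𝓝 z₀] g z₀ := by
    intro z₀
    have h1 : ∀ᶠ z in 𝓝 z₀, AnalyticAt ℂ (g z₀) z := (hg z₀).eventually_analyticAt
    have h2 : ∀ᶠ z in 𝓝 z₀, z ≠ z₀ → ∀ᶠ w in 𝓝[≠] z, H w = g z₀ w := by
      have := eventually_eventually_nhdsWithin.2 (hH z₀)
      have := eventually_nhdsWithin_iff.1 this
      filter_upwards [this] with z hz hne
      have := hz hne
      rw [(isOpen_compl_singleton.nhdsWithin_eq (s := {z₀}ᶜ) hne)] at this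
      exact this.filter_mono nhdsWithin_le_nhds
    filter_upwards [h1, h2] with z hz1 hz2
    rcases eq_or_ne z z₀ with rfl | hne
    · rfl
    · exact eq_of_eventuallyEq_punctured_nhds (hg z).continuousAt hz1.continuousAt
        ((hH z).symm.trans (hz2 hne))
  refine ⟨fun z ↦ g z z, fun z ↦ ?_, fun z ↦ ?_⟩
  · exact (hg z).differentiableAt.congr_of_eventuallyEq (key z)
  · exact (hH z).trans ((key z).filter_mono nhdsWithin_le_nhds).symm

lemma AnalyticAt.dslope_self {v : ℂ → ℂ} {a : ℂ} (hv : AnalyticAt ℂ v a) :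
    AnalyticAt ℂ (dslope v a) a :=
  let ⟨_, hp⟩ := hv
  hp.has_fpower_series_dslope_fslope.analyticAt

/-- The principal part of a quotient of analytic functions at a simple zero of the denominator. -/
lemma hasAnalyticExtensionAt_div_sub_pole {u v : ℂ → ℂ} {a : ℂ} (hu : AnalyticAt ℂ u a)
    (hv : AnalyticAt ℂ v a) (hva : v a = 0) (hda : deriv v a ≠ 0) :
    HasAnalyticExtensionAt (fun z ↦ u z / v z - u a / deriv v a / (z - a)) a := by
  -- Write `v = (z - a) e` with `e = dslope v a`. Removing the principal part of `(u/e)/(z - a)`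
  -- leaves the difference quotient of `u/e` at `a`.
  have he := hv.dslope_self
  have hea : dslope v a a ≠ 0 := by rwa [dslope_same]
  have hq : AnalyticAt ℂ (fun z ↦ u z / dslope v a z) a := hu.div he hea
  refine ⟨_, hq.dslope_self, ?_⟩
  filter_upwards [self_mem_nhdsWithin, (he.continuousAt.eventually_ne hea).filter_mono
    nhdsWithin_le_nhds] with z hz hez
  have hz' : z - a ≠ 0 := sub_ne_zero.2 hz
  have hvz : v z = (z - a) * dslope v a z := by
    simpa [hva] using (sub_smul_dslope v a z).symm
  rw [dslope_of_ne _ hz, slope_def_field, dslope_same, hvz]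
  field_simp

/-! ### Liouville arguments on a period lattice -/

namespace PeriodPair

variable (L : PeriodPair)

lemma apply_add_of_mem_lattice {G : ℂ → ℂ} (h₁ : ∀ z, G (z + L.ω₁) = G z)
    (h₂ : ∀ z, G (z + L.ω₂) = G z) {l : ℂ} (hl : l ∈ L.lattice) (z : ℂ) : G (z + l) = G z := by
  induction hl using Submodule.span_induction generalizing z with
  | mem x hx =>
    rcases hx with rfl | rfl
    exacts [h₁ z, h₂ z]
  | zero => simp
  | add x y _ _ hx hy => rw [← add_assoc, hy, hx]
  | smul a x _ hx =>
    have hp : Function.Periodic G x := hx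
    exact hp.zsmul a z

/-- Liouville's theorem for elliptic functions without poles. -/
lemma eq_of_differentiable_of_periodic {G : ℂ → ℂ} (hG : Differentiable ℂ G)
    (h₁ : ∀ z, G (z + L.ω₁) = G z) (h₂ : ∀ z, G (z + L.ω₂) = G z) (z w : ℂ) : G z = G w := by
  refine hG.apply_eq_apply_of_bounded ?_ z w
  have hb := ZSpan.fundamentalDomain_isBounded L.basis
  refine (hb.isCompact_closure.image hG.continuous).isBounded.subset ?_
  rintro _ ⟨z, rfl⟩
  refine ⟨ZSpan.fract L.basis z, subset_closure (ZSpan.fract_mem_fundamentalDomain _ _), ?_⟩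
  have hl : ((ZSpan.floor L.basis z : Submodule.span ℤ (Set.range L.basis)) : ℂ) ∈ L.lattice := by
    rw [L.lattice_eq_span_range_basis]
    exact Subtype.coe_prop _
  rw [← L.apply_add_of_mem_lattice h₁ h₂ hl, ZSpan.fract, sub_add_cancel]

/-- Differentiation kills the additive constants, so `deriv G` is entire and elliptic, hence
constant. -/
lemma eq_affine_of_quasiperiodic {G : ℂ → ℂ} (hG : Differentiable ℂ G) {c₁ c₂ : ℂ}
    (h₁ : ∀ z, G (z + L.ω₁) = G z + c₁) (h₂ : ∀ z, G (z + L.ω₂) = G z + c₂) :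
    ∃ α, ∀ z, G z = G 0 + α * z := by
  have hd : ∀ {l c : ℂ}, (∀ z, G (z + l) = G z + c) → ∀ z, deriv G (z + l) = deriv G z := by
    intro l c h z
    rw [← deriv_comp_add_const, funext h, deriv_add_const]
  have hconst := L.eq_of_differentiable_of_periodic hG.deriv (hd h₁) (hd h₂)
  refine ⟨deriv G 0, fun z ↦ ?_⟩
  have := is_const_of_deriv_eq_zero (f := fun z ↦ G z - deriv G 0 * z)
    (hG.sub (by fun_prop)) (fun w ↦ ?_) z 0
  · simp only [mul_zero, sub_zero] at this
    rw [← this]; ring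
  · have h := (hG w).hasDerivAt.sub ((hasDerivAt_id w).const_mul (deriv G 0))
    have h' := h.deriv
    simp only [id, mul_one] at h'
    rw [hconst w 0, sub_self] at h'
    exact h'

/-- A function with only removable singularities that is additively quasi-periodic agrees with
an affine function. -/
lemma exists_affine_extension {H : ℂ → ℂ} (h : ∀ z, HasAnalyticExtensionAt H z) {c₁ c₂ : ℂ}
    (h₁ : ∀ z₀, ∀ᶠ z in 𝓝[≠] z₀, H (z + L.ω₁) = H z + c₁)
    (h₂ : ∀ z₀, ∀ᶠ z in 𝓝[≠] z₀, H (z + L.ω₂) = H z + c₂) :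
    ∃ α β, α * L.ω₁ = c₁ ∧ α * L.ω₂ = c₂ ∧ ∀ z, H =ᶠ[𝓝[≠] z] fun z ↦ β + α * z := by
  obtain ⟨G, hG, hHG⟩ := exists_entire_extension h
  have hd : ∀ {l c : ℂ}, (∀ z₀, ∀ᶠ z in 𝓝[≠] z₀, H (z + l) = H z + c) →
      ∀ z, G (z + l) = G z + c := by
    intro l c h z₀
    refine eq_of_eventuallyEq_punctured_nhds (G := fun z ↦ G (z + l)) (K := fun z ↦ G z + c)
      (hG.continuous.comp (continuous_add_const l)).continuousAt
      (hG.continuous.add continuous_const).continuousAt ?_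
    filter_upwards [h z₀, hHG z₀, (tendsto_add_const_punctured_nhds z₀ l).eventually
      (hHG (z₀ + l))] with z hz hz1 hz2
    rw [← hz1, ← hz2, hz]
  obtain ⟨α, hα⟩ := L.eq_affine_of_quasiperiodic hG (hd h₁) (hd h₂)
  have h10 := hd h₁ 0
  have h20 := hd h₂ 0
  rw [zero_add, hα] at h10 h20
  refine ⟨α, G 0, by linear_combination h10, by linear_combination h20, fun z ↦ ?_⟩
  rw [← funext hα]
  exact hHG z

/-! ### The Weierstrass zeta function -/

/-- The three terms combine to `s² / (l² (s - l))`; the resulting cubic decay is summable over a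
plane lattice. -/
lemma weierstrassZeta_bound {r : ℝ} {s l : ℂ} (hs : ‖s‖ < r) (h : 2 * r ≤ ‖l‖) :
    ‖1 / (s - l) + 1 / l + s / l ^ 2‖ ≤ 2 * r ^ 2 * ‖l‖ ^ (-3 : ℝ) := by
  have hr : 0 < r := (norm_nonneg s).trans_lt hs
  have hl : 0 < ‖l‖ := by linarith
  have hl0 : l ≠ 0 := norm_pos_iff.1 hl
  have hsl : ‖l‖ / 2 ≤ ‖s - l‖ := by
    rw [norm_sub_rev]
    exact .trans (by linarith) (norm_sub_norm_le l s)
  have hsl0 : s - l ≠ 0 := norm_pos_iff.1 (by linarith)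
  calc ‖1 / (s - l) + 1 / l + s / l ^ 2‖ = ‖s‖ ^ 2 / (‖s - l‖ * ‖l‖ ^ 2) := by
        rw [← norm_pow, ← norm_pow, ← norm_mul, ← norm_div]
        congr 1
        field_simp
        ring
    _ ≤ r ^ 2 / (‖l‖ / 2 * ‖l‖ ^ 2) := by gcongr
    _ = 2 * r ^ 2 / ‖l‖ ^ 3 := by field_simp
    _ = _ := by rw [div_eq_mul_inv]; norm_cast

lemma summable_norm_rpow_neg_three : Summable fun l : L.lattice ↦ ‖(l : ℂ)‖ ^ (-3 : ℝ) :=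
  ZLattice.summable_norm_rpow _ _ (by simp; norm_num)

/-- The Weierstrass zeta function without its pole at the origin. -/
noncomputable def weierstrassZetaRegular (z : ℂ) : ℂ :=
  ∑' l : L.lattice, if l = 0 then 0 else (1 / (z - l.1) + 1 / l.1 + z / l.1 ^ 2)

lemma hasSumLocallyUniformly_weierstrassZetaRegular :
    HasSumLocallyUniformly
      (fun (l : L.lattice) (z : ℂ) ↦ if l = 0 then 0 else (1 / (z - l.1) + 1 / l.1 + z / l.1 ^ 2))
      L.weierstrassZetaRegular := by
  refine L.hasSumLocallyUniformly_aux (u := fun r l ↦ 2 * r ^ 2 * ‖(l : ℂ)‖ ^ (-3 : ℝ)) _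
    (fun _ _ ↦ L.summable_norm_rpow_neg_three.mul_left _) fun r hr ↦
    Filter.eventually_atTop.mpr ⟨2 * r, ?_⟩
  rintro _ h s hs l rfl
  split_ifs
  · simp only [norm_zero]; positivity
  · exact weierstrassZeta_bound hs h

lemma weierstrassZeta_eq (z : ℂ) : L.weierstrassZeta z = 1 / z + L.weierstrassZetaRegular z := by
  rw [weierstrassZeta, weierstrassZetaRegular]
  congr 1
  refine (tsum_subtype {l : L.lattice | l ≠ 0} fun l ↦
    1 / (z - l.1) + 1 / l.1 + z / l.1 ^ 2).trans (tsum_congr fun l ↦ ?_)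
  by_cases h : l = 0 <;> simp [Set.indicator, h]

lemma weierstrassZetaRegular_neg (z : ℂ) :
    L.weierstrassZetaRegular (-z) = -L.weierstrassZetaRegular z := by
  simp only [weierstrassZetaRegular]
  rw [← (Equiv.neg L.lattice).tsum_eq, ← tsum_neg]
  refine tsum_congr fun l ↦ ?_
  simp only [Equiv.neg_apply, neg_eq_zero]
  split_ifs with h
  · simp
  · simp only [NegMemClass.coe_neg, even_two, Even.neg_pow]
    rw [show -z - -(l : ℂ) = -(z - l) by ring]
    simp only [div_neg, neg_div]
    ring

lemma weierstrassZeta_neg (z : ℂ) : L.weierstrassZeta (-z) = -L.weierstrassZeta z := by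
  rw [weierstrassZeta_eq, weierstrassZeta_eq, weierstrassZetaRegular_neg, div_neg]
  ring

lemma isOpen_compl_lattice : IsOpen ((L.lattice : Set ℂ)ᶜ) := L.isClosed_lattice.isOpen_compl

lemma differentiableOn_zetaTerm (l : L.lattice) :
    DifferentiableOn ℂ (fun z : ℂ ↦ if l = 0 then 0 else (1 / (z - l.1) + 1 / l.1 + z / l.1 ^ 2))
      (L.lattice \ {0})ᶜ := by
  split_ifs with h
  · simp
  · refine .add (.add (.div (by fun_prop) (by fun_prop) fun z hz ↦ ?_) (by fun_prop)) (by fun_prop)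
    rw [sub_ne_zero]
    rintro rfl
    simp_all

lemma differentiableOn_weierstrassZetaRegular :
    DifferentiableOn ℂ L.weierstrassZetaRegular (L.lattice \ {0})ᶜ :=
  L.hasSumLocallyUniformly_weierstrassZetaRegular.hasSumLocallyUniformlyOn.differentiableOn
    (.of_forall fun _ ↦ .fun_sum fun i _ ↦ L.differentiableOn_zetaTerm i)
    L.isOpen_compl_lattice_sdiff

lemma deriv_weierstrassZetaRegular {z : ℂ} (hz : z ∈ ((L.lattice : Set ℂ) \ {0})ᶜ) :
    deriv L.weierstrassZetaRegular z = -L.weierstrassPExcept 0 z := by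
  have h := (L.hasSumLocallyUniformly_weierstrassZetaRegular.tendstoLocallyUniformlyOn.deriv
    (.of_forall fun _ ↦ .fun_sum fun i _ ↦ L.differentiableOn_zetaTerm i)
    L.isOpen_compl_lattice_sdiff).tendsto_at hz
  refine tendsto_nhds_unique h ((L.hasSum_weierstrassPExcept 0 z).neg.congr fun s ↦ ?_)
  have hd : ∀ l : L.lattice, DifferentiableAt ℂ
      (fun z : ℂ ↦ if l = 0 then 0 else (1 / (z - l.1) + 1 / l.1 + z / l.1 ^ 2)) z := fun l ↦
    (L.differentiableOn_zetaTerm l).differentiableAt (L.isOpen_compl_lattice_sdiff.mem_nhds hz)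
  simp only [Function.comp_apply]
  rw [deriv_fun_sum fun l _ ↦ hd l]
  refine Finset.sum_congr rfl fun l _ ↦ ?_
  by_cases hl : l = 0
  · simp [hl]
  · have hl' : (l : ℂ) ≠ 0 := by simpa using hl
    have hzl : z - l ≠ 0 := by
      rw [sub_ne_zero]
      rintro rfl
      simp_all
    simp only [hl, hl', if_false]
    have := (((hasDerivAt_const z (1 : ℂ)).div ((hasDerivAt_id z).sub_const (l : ℂ)) hzl).add_const
      (1 / (l : ℂ))).add ((hasDerivAt_id z).div_const ((l : ℂ) ^ 2))
    refine Eq.symm (this.deriv.trans ?_)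
    simp only [id]
    field_simp
    ring

lemma analyticAt_weierstrassZetaRegular {z : ℂ} (hz : z ∈ ((L.lattice : Set ℂ) \ {0})ᶜ) :
    AnalyticAt ℂ L.weierstrassZetaRegular z :=
  L.differentiableOn_weierstrassZetaRegular.analyticAt (L.isOpen_compl_lattice_sdiff.mem_nhds hz)

lemma analyticAt_weierstrassZetaRegular_zero : AnalyticAt ℂ L.weierstrassZetaRegular 0 :=
  L.analyticAt_weierstrassZetaRegular (by simp)

lemma ne_zero_of_notMem_lattice {z : ℂ} (hz : z ∉ L.lattice) : z ≠ 0 := by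
  rintro rfl
  exact hz (zero_mem _)

lemma analyticAt_weierstrassZeta {z : ℂ} (hz : z ∉ L.lattice) :
    AnalyticAt ℂ L.weierstrassZeta z := by
  rw [funext L.weierstrassZeta_eq]
  exact (analyticAt_const.div analyticAt_id (L.ne_zero_of_notMem_lattice hz)).add
    (L.analyticAt_weierstrassZetaRegular (by simp [hz]))

lemma hasDerivAt_weierstrassZeta {z : ℂ} (hz : z ∉ L.lattice) :
    HasDerivAt L.weierstrassZeta (-L.weierstrassP z) z := by
  have hz0 := L.ne_zero_of_notMem_lattice hz
  have hz' : z ∈ ((L.lattice : Set ℂ) \ {0})ᶜ := by simp [hz]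
  have h2 := (L.analyticAt_weierstrassZetaRegular hz').differentiableAt.hasDerivAt
  rw [L.deriv_weierstrassZetaRegular hz'] at h2
  rw [funext L.weierstrassZeta_eq]
  refine (((hasDerivAt_const z (1 : ℂ)).div (hasDerivAt_id z) hz0).add h2).congr_deriv ?_
  rw [← L.weierstrassPExcept_add 0 z]
  simp
  ring

lemma countable_lattice : (L.lattice : Set ℂ).Countable :=
  Set.countable_coe_iff.1 (L.latticeEquivProd.toEquiv.countable_iff.2 inferInstance)

lemma isPreconnected_compl_lattice : IsPreconnected ((L.lattice : Set ℂ)ᶜ) :=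
  (L.countable_lattice.isConnected_compl_of_one_lt_rank (by simp)).isPreconnected

lemma add_notMem_lattice {z l : ℂ} (hl : l ∈ L.lattice) (hz : z ∉ L.lattice) :
    z + l ∉ L.lattice := by
  rwa [Submodule.add_mem_iff_left _ hl]

lemma eq_of_deriv_eq_zero_off_lattice {u : ℂ → ℂ} (h : ∀ z ∉ L.lattice, HasDerivAt u 0 z) {z w : ℂ}
    (hz : z ∉ L.lattice) (hw : w ∉ L.lattice) : u z = u w :=
  L.isOpen_compl_lattice.is_const_of_deriv_eq_zero L.isPreconnected_compl_lattice
    (fun z hz ↦ (h z hz).differentiableAt.differentiableWithinAt) (fun z hz ↦ (h z hz).deriv) hz hw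

/-- The quasi-periods of the Weierstrass zeta function. -/
noncomputable def quasiPeriod (l : ℂ) : ℂ :=
  L.weierstrassZeta (L.ω₁ / 2 + l) - L.weierstrassZeta (L.ω₁ / 2)

/-- Since `ζ' = -℘` is periodic, `ζ(z + l) - ζ(z)` has zero derivative off the lattice, whose
complement is connected because the lattice is countable. -/
lemma weierstrassZeta_add {z l : ℂ} (hl : l ∈ L.lattice) (hz : z ∉ L.lattice) :
    L.weierstrassZeta (z + l) = L.weierstrassZeta z + L.quasiPeriod l := by
  have := L.eq_of_deriv_eq_zero_off_lattice
    (u := fun z ↦ L.weierstrassZeta (z + l) - L.weierstrassZeta z) (fun w hw ↦ ?_) hz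
    L.ω₁_div_two_notMem_lattice
  · rw [quasiPeriod, ← this]; ring
  · have h := ((L.hasDerivAt_weierstrassZeta (L.add_notMem_lattice hl hw)).comp_add_const w l).sub
      (L.hasDerivAt_weierstrassZeta hw)
    rw [L.weierstrassP_add_coe w ⟨l, hl⟩, sub_self] at h
    exact h

/-- Translate from `-ω₁/2` to `ω₁/2` and use that `ζ` is odd. -/
lemma quasiPeriod_ω₁ : L.quasiPeriod L.ω₁ = L.eta₁ := by
  have h : -(L.ω₁ / 2) ∉ L.lattice := by simpa using L.ω₁_div_two_notMem_lattice
  have := L.weierstrassZeta_add L.ω₁_mem_lattice h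
  rw [weierstrassZeta_neg, show -(L.ω₁ / 2) + L.ω₁ = L.ω₁ / 2 by ring] at this
  rw [eta₁]
  linear_combination -this

end PeriodPair

/-! ### The Weierstrass sigma function -/

/-- The exponent cancels the terms of order one and two: the derivative is exactly `-x² exp(x +
x²/2)`, so the mean value inequality gives a cubic bound. -/
lemma norm_one_sub_mul_exp_sub_one_le {w : ℂ} (hw : ‖w‖ ≤ 1 / 2) :
    ‖(1 - w) * Complex.exp (w + w ^ 2 / 2) - 1‖ ≤ Real.exp 1 * ‖w‖ ^ 3 := by
  have hd : ∀ x : ℂ, HasDerivAt (fun x ↦ (1 - x) * Complex.exp (x + x ^ 2 / 2))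
      (-x ^ 2 * Complex.exp (x + x ^ 2 / 2)) x := fun x ↦ by
    have h := ((hasDerivAt_id x).const_sub 1).mul
      (((hasDerivAt_id x).add (((hasDerivAt_id x).pow 2).div_const 2)).cexp)
    refine h.congr_deriv ?_
    simp
    ring
  have := (convex_closedBall (0 : ℂ) ‖w‖).norm_image_sub_le_of_norm_hasDerivWithin_le
    (f := fun x ↦ (1 - x) * Complex.exp (x + x ^ 2 / 2)) (C := Real.exp 1 * ‖w‖ ^ 2)
    (x := 0) (y := w)
    (fun x _ ↦ (hd x).hasDerivWithinAt) (fun x hx ↦ ?_) (by simp) (by simp)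
  · simp only [sub_zero, one_mul, ne_eq, OfNat.ofNat_ne_zero, not_false_eq_true, zero_pow, zero_div,
      add_zero, Complex.exp_zero] at this
    exact this.trans_eq (by ring)
  · have hx' : ‖x‖ ≤ ‖w‖ := by simpa using hx
    rw [norm_mul, norm_neg, norm_pow, mul_comm]
    have h1 : ‖x + x ^ 2 / 2‖ ≤ 1 := by
      refine (norm_add_le _ _).trans ?_
      rw [norm_div, norm_pow, Complex.norm_ofNat]
      nlinarith [norm_nonneg x]
    gcongr
    exact (Complex.norm_exp_le_exp_norm _).trans (Real.exp_le_exp.2 h1)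

namespace PeriodPair

variable (L : PeriodPair)

/-- The factor of the Weierstrass sigma function attached to a nonzero period. -/
noncomputable def sigmaFactor (l : {l : L.lattice // l ≠ 0}) (z : ℂ) : ℂ :=
  (1 - z / (l.1 : ℂ)) * Complex.exp (z / (l.1 : ℂ) + z ^ 2 / (2 * (l.1 : ℂ) ^ 2))

/-- The Weierstrass sigma function without its zero at the origin. -/
noncomputable def weierstrassSigmaRegular (z : ℂ) : ℂ := ∏' l, L.sigmaFactor l z

lemma weierstrassSigma_eq (z : ℂ) : L.weierstrassSigma z = z * L.weierstrassSigmaRegular z := rfl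

lemma norm_sigmaFactor_sub_one_le {r : ℝ} {z : ℂ} (hz : ‖z‖ < r) (l : {l : L.lattice // l ≠ 0})
    (hl : 2 * r ≤ ‖(l.1 : ℂ)‖) :
    ‖L.sigmaFactor l z - 1‖ ≤ Real.exp 1 * r ^ 3 * ‖(l.1 : ℂ)‖ ^ (-3 : ℝ) := by
  have hr : 0 < r := (norm_nonneg z).trans_lt hz
  have hl0 : 0 < ‖(l.1 : ℂ)‖ := by linarith
  have hw : ‖z / (l.1 : ℂ)‖ ≤ 1 / 2 := by
    rw [norm_div, div_le_div_iff₀ hl0 two_pos]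
    linarith
  have h := norm_one_sub_mul_exp_sub_one_le hw
  rw [div_pow, div_div, mul_comm (_ ^ 2) (2 : ℂ)] at h
  refine h.trans ?_
  rw [norm_div, div_pow, mul_assoc]
  have : ‖(l.1 : ℂ)‖ ^ (-3 : ℝ) = (‖(l.1 : ℂ)‖ ^ 3)⁻¹ := by norm_cast
  rw [this, ← div_eq_mul_inv]
  gcongr

lemma summable_norm_rpow_neg_three_nonzero :
    Summable fun l : {l : L.lattice // l ≠ 0} ↦ ‖(l.1 : ℂ)‖ ^ (-3 : ℝ) :=
  L.summable_norm_rpow_neg_three.comp_injective Subtype.val_injective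

lemma eventually_cofinite_le_norm (R : ℝ) :
    ∀ᶠ l : {l : L.lattice // l ≠ 0} in cofinite, R ≤ ‖(l.1 : ℂ)‖ := by
  have h : ∀ᶠ l : L.lattice in cofinite, R ≤ ‖(l : ℂ)‖ := by
    refine (isCompact_iff_finite.mp (isCompact_closedBall (0 : L.lattice) R)).subset fun l hl ↦ ?_
    simp only [Set.mem_compl_iff, Set.mem_ofPred_eq, not_le] at hl
    simpa using hl.le
  exact Subtype.val_injective.tendsto_cofinite.eventually h

lemma eventually_norm_sigmaFactor_sub_one_le (r : ℝ) :
    ∀ᶠ l in cofinite, ∀ z ∈ Metric.ball (0 : ℂ) r,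
      ‖L.sigmaFactor l z - 1‖ ≤ Real.exp 1 * r ^ 3 * ‖(l.1 : ℂ)‖ ^ (-3 : ℝ) := by
  filter_upwards [L.eventually_cofinite_le_norm (2 * r)] with l hl z hz
  exact L.norm_sigmaFactor_sub_one_le (by simpa using hz) l hl

lemma differentiable_sigmaFactor (l : {l : L.lattice // l ≠ 0}) :
    Differentiable ℂ (L.sigmaFactor l) := by
  unfold sigmaFactor
  fun_prop

lemma hasProdLocallyUniformlyOn_sigmaFactor (r : ℝ) :
    HasProdLocallyUniformlyOn L.sigmaFactor L.weierstrassSigmaRegular (Metric.ball 0 r) := by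
  have := Summable.hasProdLocallyUniformlyOn_one_add (f := fun l z ↦ L.sigmaFactor l z - 1)
    Metric.isOpen_ball (L.summable_norm_rpow_neg_three_nonzero.mul_left _)
    (L.eventually_norm_sigmaFactor_sub_one_le r)
    fun l ↦ ((L.differentiable_sigmaFactor l).sub_const 1).continuous.continuousOn
  simpa only [add_sub_cancel] using! this

lemma differentiable_weierstrassSigmaRegular : Differentiable ℂ L.weierstrassSigmaRegular := by
  intro z
  have hz : z ∈ Metric.ball (0 : ℂ) (‖z‖ + 1) := by simp
  refine DifferentiableOn.differentiableAt ?_ (Metric.isOpen_ball.mem_nhds hz)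
  exact (hasProdLocallyUniformlyOn_iff_tendstoLocallyUniformlyOn.1
    (L.hasProdLocallyUniformlyOn_sigmaFactor (‖z‖ + 1))).differentiableOn
    (.of_forall fun s ↦ .fun_finsetProd fun i _ ↦ (L.differentiable_sigmaFactor i).differentiableOn)
    Metric.isOpen_ball

lemma differentiable_weierstrassSigma : Differentiable ℂ L.weierstrassSigma :=
  differentiable_id.mul L.differentiable_weierstrassSigmaRegular

lemma sigmaFactor_ne_zero {z : ℂ} (hz : z ∈ ((L.lattice : Set ℂ) \ {0})ᶜ)
    (l : {l : L.lattice // l ≠ 0}) : L.sigmaFactor l z ≠ 0 := by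
  have hl : (l.1 : ℂ) ≠ 0 := by simpa using l.2
  refine mul_ne_zero (fun h ↦ hz ?_) (Complex.exp_ne_zero _)
  rw [sub_eq_zero, eq_div_iff hl, one_mul] at h
  exact ⟨h ▸ l.1.2, by simpa [← h] using l.2⟩

lemma weierstrassSigmaRegular_ne_zero {z : ℂ} (hz : z ∈ ((L.lattice : Set ℂ) \ {0})ᶜ) :
    L.weierstrassSigmaRegular z ≠ 0 := by
  have := tprod_one_add_ne_zero_of_summable (f := fun l ↦ L.sigmaFactor l z - 1)
    (fun l ↦ by simpa using L.sigmaFactor_ne_zero hz l) ?_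
  · simpa only [add_sub_cancel] using! this
  · refine Summable.of_norm_bounded_eventually
      (L.summable_norm_rpow_neg_three_nonzero.mul_left (Real.exp 1 * (‖z‖ + 1) ^ 3)) ?_
    filter_upwards [L.eventually_norm_sigmaFactor_sub_one_le (‖z‖ + 1)] with l hl
    simpa using hl z (by simp)

lemma weierstrassSigmaRegular_zero : L.weierstrassSigmaRegular 0 = 1 := by
  simp [weierstrassSigmaRegular, sigmaFactor]

lemma weierstrassSigma_ne_zero {z : ℂ} (hz : z ∉ L.lattice) : L.weierstrassSigma z ≠ 0 :=
  mul_ne_zero (L.ne_zero_of_notMem_lattice hz) (L.weierstrassSigmaRegular_ne_zero (by simp [hz]))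

lemma weierstrassSigma_zero : L.weierstrassSigma 0 = 0 := zero_mul _

lemma hasDerivAt_weierstrassSigma_zero : HasDerivAt L.weierstrassSigma 1 0 := by
  have := (hasDerivAt_id (0 : ℂ)).mul (L.differentiable_weierstrassSigmaRegular 0).hasDerivAt
  refine this.congr_deriv ?_
  simp [weierstrassSigmaRegular_zero]

lemma logDeriv_sigmaFactor {z : ℂ} (hz : z ∉ L.lattice) (l : {l : L.lattice // l ≠ 0}) :
    logDeriv (L.sigmaFactor l) z = 1 / (z - l.1) + 1 / l.1 + z / l.1 ^ 2 := by
  have hl : (l.1 : ℂ) ≠ 0 := by simpa using l.2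
  have hzl : z - l.1 ≠ 0 := by
    rw [sub_ne_zero]
    rintro rfl
    exact hz l.1.2
  have h := (((hasDerivAt_id z).div_const (l.1 : ℂ)).const_sub 1).mul
    ((((hasDerivAt_id z).div_const (l.1 : ℂ)).add
      (((hasDerivAt_id z).pow 2).div_const (2 * (l.1 : ℂ) ^ 2))).cexp)
  have h0 := L.sigmaFactor_ne_zero (by simp [hz]) l (z := z)
  rw [logDeriv_apply, div_eq_iff h0]
  refine h.deriv.trans ?_
  rw [sigmaFactor]
  have hE := Complex.exp_ne_zero (z / (l.1 : ℂ) + z ^ 2 / (2 * (l.1 : ℂ) ^ 2))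
  simp only [id, Pi.add_apply, Pi.pow_apply]
  generalize Complex.exp (z / (l.1 : ℂ) + z ^ 2 / (2 * (l.1 : ℂ) ^ 2)) = e at *
  field_simp
  ring

/-- The logarithmic derivative of the product is the sum of those of its factors, which are the
terms of the zeta series. -/
lemma hasDerivAt_weierstrassSigma {z : ℂ} (hz : z ∉ L.lattice) :
    HasDerivAt L.weierstrassSigma (L.weierstrassZeta z * L.weierstrassSigma z) z := by
  have hz0 := L.ne_zero_of_notMem_lattice hz
  have hP := L.weierstrassSigmaRegular_ne_zero (z := z) (by simp [hz])
  have hsum : Summable fun l : {l : L.lattice // l ≠ 0} ↦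
      1 / (z - (l.1 : ℂ)) + 1 / (l.1 : ℂ) + z / (l.1 : ℂ) ^ 2 := by
    refine ((L.hasSumLocallyUniformly_weierstrassZetaRegular.hasSum
      (x := z)).summable.comp_injective Subtype.val_injective).congr fun l ↦ ?_
    simp [l.2]
  have h : logDeriv L.weierstrassSigmaRegular z = _ := logDeriv_tprod_eq_tsum
    (Metric.isOpen_ball (x := (0 : ℂ)) (ε := ‖z‖ + 1)) (x := z)
    (by simp) (L.sigmaFactor_ne_zero (by simp [hz]))
    (fun l ↦ (L.differentiable_sigmaFactor l).differentiableOn)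
    (by simpa only [L.logDeriv_sigmaFactor hz] using hsum)
    ⟨_, L.hasProdLocallyUniformlyOn_sigmaFactor _⟩ hP
  simp only [L.logDeriv_sigmaFactor hz] at h
  rw [logDeriv_apply, div_eq_iff hP] at h
  have hd := (hasDerivAt_id z).mul (L.differentiable_weierstrassSigmaRegular z).hasDerivAt
  refine hd.congr_deriv ?_
  rw [h, weierstrassZeta, weierstrassSigma_eq]
  simp only [id]
  field_simp

/-- The quotient of the two sides without `C` has logarithmic derivative `ζ(z + l) - ζ(z) -
quasiPeriod l = 0`. The value of `C` is left open because it cancels in the later quotients. -/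
lemma exists_weierstrassSigma_add {l : ℂ} (hl : l ∈ L.lattice) :
    ∃ C, C ≠ 0 ∧ ∀ z ∉ L.lattice,
      L.weierstrassSigma (z + l) =
        C * Complex.exp (L.quasiPeriod l * z) * L.weierstrassSigma z := by
  set u : ℂ → ℂ := fun z ↦
    L.weierstrassSigma (z + l) / (Complex.exp (L.quasiPeriod l * z) * L.weierstrassSigma z) with hu
  have hne : ∀ z ∉ L.lattice, Complex.exp (L.quasiPeriod l * z) * L.weierstrassSigma z ≠ 0 :=
    fun z hz ↦ mul_ne_zero (Complex.exp_ne_zero _) (L.weierstrassSigma_ne_zero hz)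
  have hw := L.ω₁_div_two_notMem_lattice
  refine ⟨u (L.ω₁ / 2), div_ne_zero (L.weierstrassSigma_ne_zero (L.add_notMem_lattice hl hw))
    (hne _ hw), fun z hz ↦ ?_⟩
  rw [← L.eq_of_deriv_eq_zero_off_lattice (u := u) (fun z hz ↦ ?_) hz hw, hu, mul_assoc]
  · exact (div_mul_cancel₀ _ (hne z hz)).symm
  · have h1 := (L.hasDerivAt_weierstrassSigma (L.add_notMem_lattice hl hz)).comp_add_const z l
    have h2 := (((hasDerivAt_id z).const_mul (L.quasiPeriod l)).cexp).mul
      (L.hasDerivAt_weierstrassSigma hz)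
    refine (h1.div h2 (hne z hz)).congr_deriv ?_
    rw [L.weierstrassZeta_add hl hz]
    simp only [Pi.mul_apply, id]
    refine div_eq_zero_iff.2 (Or.inl ?_)
    ring

end PeriodPair

/-! ### Legendre's relation by comparison with the cotangent -/

/-- The function `π cot (π z)`, written in terms of `exp (2 π i z)`. -/
noncomputable def piCot (z : ℂ) : ℂ :=
  Real.pi * Complex.I * (Complex.exp (2 * Real.pi * Complex.I * z) + 1) /
    (Complex.exp (2 * Real.pi * Complex.I * z) - 1)

lemma exp_two_pi_I_mul_add_one (z : ℂ) : Complex.exp (2 * Real.pi * Complex.I * (z + 1)) =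
    Complex.exp (2 * Real.pi * Complex.I * z) := by
  rw [mul_add, mul_one, Complex.exp_add, Complex.exp_two_pi_mul_I, mul_one]

lemma piCot_add_one (z : ℂ) : piCot (z + 1) = piCot z := by
  rw [piCot, exp_two_pi_I_mul_add_one, piCot]

lemma piCot_neg (z : ℂ) : piCot (-z) = -piCot z := by
  have he := Complex.exp_ne_zero (2 * Real.pi * Complex.I * z)
  rw [piCot, piCot, mul_neg, Complex.exp_neg]
  generalize Complex.exp (2 * Real.pi * Complex.I * z) = e at *
  rcases eq_or_ne e 1 with rfl | h
  · simp
  · have h1 : e - 1 ≠ 0 := sub_ne_zero.2 h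
    have h2 : 1 - e ≠ 0 := sub_ne_zero.2 h.symm
    field_simp
    ring

lemma exp_two_pi_I_mul_eq_one_iff (z : ℂ) :
    Complex.exp (2 * Real.pi * Complex.I * z) = 1 ↔ ∃ n : ℤ, z = n := by
  rw [Complex.exp_eq_one_iff]
  refine exists_congr fun n ↦ ?_
  rw [mul_comm (n : ℂ), mul_right_inj' Complex.two_pi_I_ne_zero]

lemma analyticAt_piCot {z : ℂ} (hz : ∀ n : ℤ, z ≠ n) : AnalyticAt ℂ piCot z := by
  refine AnalyticAt.div (by fun_prop) (by fun_prop) ?_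
  rw [sub_ne_zero, Ne, exp_two_pi_I_mul_eq_one_iff]
  rintro ⟨n, rfl⟩
  exact hz n rfl

lemma hasAnalyticExtensionAt_piCot_sub : HasAnalyticExtensionAt (fun z ↦ piCot z - 1 / z) 0 := by
  have hd : HasDerivAt (fun z ↦ Complex.exp (2 * Real.pi * Complex.I * z) - 1)
      (2 * Real.pi * Complex.I) 0 := by
    have := (((hasDerivAt_id (0 : ℂ)).const_mul (2 * Real.pi * Complex.I)).cexp).sub_const 1
    refine this.congr_deriv ?_
    simp
  have := hasAnalyticExtensionAt_div_sub_pole (a := 0)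
    (u := fun z ↦ Real.pi * Complex.I * (Complex.exp (2 * Real.pi * Complex.I * z) + 1))
    (v := fun z ↦ Complex.exp (2 * Real.pi * Complex.I * z) - 1) (by fun_prop) (by fun_prop)
    (by simp) (by rw [hd.deriv]; exact Complex.two_pi_I_ne_zero)
  refine this.congr (.of_eq (funext fun z ↦ ?_))
  rw [hd.deriv, sub_zero, mul_zero, Complex.exp_zero, piCot]
  congr 2
  have := Complex.two_pi_I_ne_zero
  field_simp
  ring

lemma norm_exp_two_pi_I_mul_lt_one {z : ℂ} (hz : 0 < z.im) :
    ‖Complex.exp (2 * Real.pi * Complex.I * z)‖ < 1 := by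
  rw [Complex.norm_exp, Real.exp_lt_one_iff]
  have : (2 * Real.pi * Complex.I * z).re = -(2 * Real.pi * z.im) := by simp
  rw [this]
  have := Real.pi_pos
  have : 0 < 2 * Real.pi * z.im := by positivity
  linarith

/-- In the upper half-plane `|exp(2πiz)| < 1`, so `1 - exp(2πiz)` stays in the right half-plane,
where the principal logarithm is holomorphic. -/
lemma hasDerivAt_piCot_primitive {z : ℂ} (hz : 0 < z.im) :
    HasDerivAt (fun z ↦ Complex.log (1 - Complex.exp (2 * Real.pi * Complex.I * z))
      - Real.pi * Complex.I * z) (piCot z) z := by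
  have hn := norm_exp_two_pi_I_mul_lt_one hz
  have hs : 1 - Complex.exp (2 * Real.pi * Complex.I * z) ∈ Complex.slitPlane := by
    refine Or.inl ?_
    have := (Complex.re_le_norm (Complex.exp (2 * Real.pi * Complex.I * z))).trans_lt hn
    simpa using this
  have h := (((((hasDerivAt_id z).const_mul (2 * Real.pi * Complex.I)).cexp).const_sub 1).clog
    hs).sub ((hasDerivAt_id z).const_mul (Real.pi * Complex.I))
  refine h.congr_deriv ?_
  have h0 := Complex.slitPlane_ne_zero hs
  have h1 : Complex.exp (2 * Real.pi * Complex.I * z) - 1 ≠ 0 := by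
    rw [← neg_ne_zero, neg_sub]
    exact h0
  simp only [id, piCot] at *
  generalize Complex.exp (2 * Real.pi * Complex.I * z) = e at *
  field_simp
  ring

/-- Over a full period the logarithm in the primitive cancels, and only its linear part `-πiz`
contributes. -/
lemma integral_piCot {y : ℝ} (hy : 0 < y) :
    ∫ x : ℝ in (-1 / 2)..(1 / 2), piCot (x + y * Complex.I) = -(Real.pi * Complex.I) := by
  have him : ∀ x : ℝ, ((x : ℂ) + y * Complex.I).im = y := fun x ↦ by simp
  have hc : Continuous fun x : ℝ ↦ piCot (x + y * Complex.I) := by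
    rw [continuous_iff_continuousAt]
    intro x
    have : AnalyticAt ℂ piCot (x + y * Complex.I) := analyticAt_piCot fun n hn ↦ by
      have := him x
      rw [hn] at this
      simp only [Complex.intCast_im] at this
      exact hy.ne this
    exact ContinuousAt.comp (f := fun x : ℝ ↦ (x : ℂ) + y * Complex.I) this.continuousAt
      (by fun_prop)
  rw [intervalIntegral.integral_eq_sub_of_hasDerivAt (fun x _ ↦
    ((hasDerivAt_piCot_primitive (by rw [him]; exact hy)).comp_add_const (x : ℂ)
      (y * Complex.I)).comp_ofReal) (hc.intervalIntegrable _ _)]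
  have : (((1 / 2 : ℝ) : ℂ) + y * Complex.I) = ((-1 / 2 : ℝ) : ℂ) + y * Complex.I + 1 := by
    push_cast
    ring
  rw [this, exp_two_pi_I_mul_add_one]
  ring

namespace PeriodPair

variable (L : PeriodPair)

lemma exists_int_eq_of_abs_im_lt (h₁ : L.ω₁ = 1) {z : ℂ} (hz : z ∈ L.lattice)
    (him : |z.im| < L.ω₂.im) : ∃ m : ℤ, z = m := by
  obtain ⟨m, n, rfl⟩ := mem_lattice.1 hz
  refine ⟨m, ?_⟩
  have hpos : 0 < L.ω₂.im := (abs_nonneg _).trans_lt him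
  have hn : n = 0 := by
    simp only [h₁, mul_one, Complex.add_im, Complex.intCast_im, Complex.mul_im, Complex.intCast_re,
      zero_mul, add_zero, zero_add, abs_mul, abs_of_pos hpos] at him
    have : |(n : ℝ)| < 1 := by
      by_contra! h
      nlinarith
    exact Int.abs_lt_one_iff.1 (by exact_mod_cast this)
  simp [hn, h₁]

lemma intCast_mem_lattice (h₁ : L.ω₁ = 1) (n : ℤ) : (n : ℂ) ∈ L.lattice :=
  mem_lattice.2 ⟨n, 0, by simp [h₁]⟩

/-- The difference of two `1`-periodic functions with the same simple pole at the origin. -/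
noncomputable def zetaSubCot (z : ℂ) : ℂ := L.weierstrassZeta z - L.eta₁ * z - piCot z

lemma zetaSubCot_neg (z : ℂ) : L.zetaSubCot (-z) = -L.zetaSubCot z := by
  rw [zetaSubCot, zetaSubCot, weierstrassZeta_neg, piCot_neg]
  ring

lemma zetaSubCot_add_one (h₁ : L.ω₁ = 1) {z : ℂ} (hz : z ∉ L.lattice) :
    L.zetaSubCot (z + 1) = L.zetaSubCot z := by
  have := L.weierstrassZeta_add L.ω₁_mem_lattice hz
  rw [quasiPeriod_ω₁, h₁] at this
  rw [zetaSubCot, zetaSubCot, this, piCot_add_one]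
  ring

lemma analyticAt_zetaSubCot (h₁ : L.ω₁ = 1) {z : ℂ} (hz : z ∉ L.lattice) :
    AnalyticAt ℂ L.zetaSubCot z :=
  ((L.analyticAt_weierstrassZeta hz).sub (analyticAt_const.mul analyticAt_id)).sub
    (analyticAt_piCot fun n hn ↦ hz (hn ▸ L.intCast_mem_lattice h₁ n))

lemma hasAnalyticExtensionAt_zetaSubCot : HasAnalyticExtensionAt L.zetaSubCot 0 := by
  have h1 : AnalyticAt ℂ (fun z ↦ L.weierstrassZetaRegular z - L.eta₁ * z) 0 :=
    L.analyticAt_weierstrassZetaRegular_zero.sub (analyticAt_const.mul analyticAt_id)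
  refine (h1.hasAnalyticExtensionAt.sub hasAnalyticExtensionAt_piCot_sub).congr
    (.of_eq (funext fun z ↦ ?_))
  rw [zetaSubCot, weierstrassZeta_eq]
  ring

/-- Cauchy's theorem on the rectangle with corners `±1/2 ± iy`, whose only lattice point is the
removable singularity 0. The vertical sides cancel by periodicity, and oddness makes the bottom
integral minus the top one. -/
lemma integral_zetaSubCot (h₁ : L.ω₁ = 1) {y : ℝ} (hy : 0 < y) (hy₂ : y < L.ω₂.im) :
    ∫ x : ℝ in (-1 / 2)..(1 / 2), L.zetaSubCot (x + y * Complex.I) = 0 := by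
  obtain ⟨g, hg, hgz⟩ := L.hasAnalyticExtensionAt_zetaSubCot
  set φ := Function.update L.zetaSubCot 0 (g 0) with hφ
  have hφne : ∀ z ≠ 0, φ z = L.zetaSubCot z := fun z hz ↦ Function.update_of_ne hz _ _
  have hφg : φ =ᶠ[𝓝 0] g := by
    refine eventuallyEq_nhds_of_eventuallyEq_nhdsNE ?_ (Function.update_self ..)
    filter_upwards [hgz, self_mem_nhdsWithin] with z hz hz0
    rw [hφne z hz0, hz]
  have hmem : ∀ z : ℂ, |z.re| ≤ 1 / 2 → |z.im| ≤ y → z ≠ 0 → z ∉ L.lattice := by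
    intro z hre him hz0 hz
    obtain ⟨m, rfl⟩ := L.exists_int_eq_of_abs_im_lt h₁ hz (him.trans_lt hy₂)
    have hm : |(m : ℝ)| < 1 := by simpa using hre.trans_lt (by norm_num)
    have : m = 0 := Int.abs_lt_one_iff.1 (by exact_mod_cast hm)
    simp [this] at hz0
  have hdiff : ∀ z : ℂ, |z.re| ≤ 1 / 2 → |z.im| ≤ y → DifferentiableAt ℂ φ z := by
    intro z hre him
    rcases eq_or_ne z 0 with rfl | hz0
    · exact hg.differentiableAt.congr_of_eventuallyEq hφg
    · refine (L.analyticAt_zetaSubCot h₁ (hmem z hre him hz0)).differentiableAt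
        |>.congr_of_eventuallyEq ?_
      filter_upwards [isOpen_ne.mem_nhds hz0] with w hw using hφne w hw
  have hrect := Complex.integral_boundary_rect_eq_zero_of_differentiableOn φ
    (⟨-1 / 2, -y⟩ : ℂ) ⟨1 / 2, y⟩ fun z hz ↦ by
      rw [Complex.mem_reProdIm, Set.uIcc_of_le (by norm_num),
        Set.uIcc_of_le (by simp; linarith)] at hz
      refine (hdiff z (abs_le.2 ⟨?_, hz.1.2⟩) (abs_le.2 hz.2)).differentiableWithinAt
      have := hz.1.1
      simp only at this
      linarith
  simp only at hrect
  have hne : ∀ x v : ℝ, v ≠ 0 → (x : ℂ) + v * Complex.I ≠ 0 := fun x v hv h ↦ hv (by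
    simpa using congrArg Complex.im h)
  have hvert : ∫ v : ℝ in (-y)..y, φ ((1 / 2 : ℝ) + v * Complex.I) =
      ∫ v : ℝ in (-y)..y, φ ((-1 / 2 : ℝ) + v * Complex.I) := by
    refine intervalIntegral.integral_congr fun v hv ↦ ?_
    rw [Set.uIcc_of_le (by linarith)] at hv
    have hne' : ∀ x : ℝ, x ≠ 0 → (x : ℂ) + v * Complex.I ≠ 0 := fun x hx h ↦ hx (by
      simpa using congrArg Complex.re h)
    have hmem' := hmem ((-1 / 2 : ℝ) + v * Complex.I) (by simp [abs_of_pos, abs_div])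
      (by simpa using abs_le.2 hv) (hne' _ (by norm_num))
    rw [hφne _ (hne' _ (by norm_num)), hφne _ (hne' _ (by norm_num)),
      ← L.zetaSubCot_add_one h₁ hmem']
    congr 1
    push_cast
    ring
  have hbot : ∫ x : ℝ in (-1 / 2)..(1 / 2), φ (x + ((-y : ℝ) : ℂ) * Complex.I) =
      -∫ x : ℝ in (-1 / 2)..(1 / 2), L.zetaSubCot (x + y * Complex.I) := by
    have := intervalIntegral.integral_comp_neg (a := -1 / 2) (b := 1 / 2)
      fun x : ℝ ↦ L.zetaSubCot (x + y * Complex.I)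
    rw [show -(-1 / 2 : ℝ) = 1 / 2 by norm_num, show -(1 / 2 : ℝ) = -1 / 2 by norm_num] at this
    rw [← this, ← intervalIntegral.integral_neg]
    refine intervalIntegral.integral_congr fun x _ ↦ ?_
    rw [hφne _ (hne _ _ (by linarith)), ← zetaSubCot_neg]
    congr 1
    push_cast
    ring
  have htop : ∫ x : ℝ in (-1 / 2)..(1 / 2), φ (x + y * Complex.I) =
      ∫ x : ℝ in (-1 / 2)..(1 / 2), L.zetaSubCot (x + y * Complex.I) :=
    intervalIntegral.integral_congr fun x _ ↦ hφne _ (hne _ _ hy.ne')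
  rw [hvert, hbot, htop] at hrect
  linear_combination -hrect / 2

lemma notMem_lattice_of_im (h₁ : L.ω₁ = 1) {z : ℂ} (h0 : z.im ≠ 0) (him : |z.im| < L.ω₂.im) :
    z ∉ L.lattice := fun hz ↦ by
  obtain ⟨m, rfl⟩ := L.exists_int_eq_of_abs_im_lt h₁ hz him
  simp at h0

/-- **Legendre's relation** between the quasi-periods of the Weierstrass zeta function. -/
theorem legendre_relation (h₁ : L.ω₁ = 1) (h₂ : 0 < L.ω₂.im) :
    L.eta₁ * L.ω₂ - L.quasiPeriod L.ω₂ = 2 * Real.pi * Complex.I := by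
  -- `ψ` is odd and 1-periodic, with integral `-πi` along a period at height `Im ω₂ / 2`. The
  -- reflection `x ↦ -x` about `ω₂/2` makes `ψ(ω₂/2 + x) + ψ(ω₂/2 - x)` the constant `quasiPeriod ω₂
  -- - η₁ ω₂`; integrating it yields the relation.
  set ψ : ℂ → ℂ := fun z ↦ L.weierstrassZeta z - L.eta₁ * z with hψ
  set y := L.ω₂.im / 2 with hy
  have hmem : ∀ x : ℝ, (x : ℂ) + y * Complex.I ∉ L.lattice := fun x ↦ by
    refine L.notMem_lattice_of_im h₁ ?_ ?_
    · simp [hy, h₂.ne']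
    · simpa [abs_of_pos (half_pos h₂), hy] using half_lt_self h₂
  have hcontψ : Continuous fun x : ℝ ↦ ψ (x + y * Complex.I) := by
    rw [continuous_iff_continuousAt]
    intro x
    have : AnalyticAt ℂ ψ (x + y * Complex.I) :=
      (L.analyticAt_weierstrassZeta (hmem x)).sub (analyticAt_const.mul analyticAt_id)
    exact ContinuousAt.comp (f := fun x : ℝ ↦ (x : ℂ) + y * Complex.I) this.continuousAt
      (by fun_prop)
  have hcontz : Continuous fun x : ℝ ↦ L.zetaSubCot (x + y * Complex.I) := by
    rw [continuous_iff_continuousAt]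
    intro x
    exact ContinuousAt.comp (f := fun x : ℝ ↦ (x : ℂ) + y * Complex.I)
      (L.analyticAt_zetaSubCot h₁ (hmem x)).continuousAt (by fun_prop)
  have hint : ∫ x : ℝ in (-1 / 2)..(1 / 2), ψ (x + y * Complex.I) = -(Real.pi * Complex.I) := by
    rw [← integral_piCot (y := y) (by positivity)]
    have := intervalIntegral.integral_sub (μ := MeasureTheory.volume)
      (hcontψ.intervalIntegrable (-1 / 2) (1 / 2)) (hcontz.intervalIntegrable (-1 / 2) (1 / 2))
    rw [L.integral_zetaSubCot h₁ (by positivity) (by rw [hy]; linarith), sub_zero] at this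
    rw [← this]
    refine intervalIntegral.integral_congr fun x _ ↦ ?_
    simp only [hψ, zetaSubCot]
    ring
  have hper : Function.Periodic (fun x : ℝ ↦ ψ (x + y * Complex.I)) 1 := fun x ↦ by
    have := L.weierstrassZeta_add L.ω₁_mem_lattice (hmem x)
    rw [quasiPeriod_ω₁, h₁] at this
    simp only [hψ]
    push_cast
    rw [show (x : ℂ) + 1 + y * Complex.I = x + y * Complex.I + 1 by ring, this]
    ring
  have hhalf : ∀ x : ℝ, (x : ℂ) + L.ω₂ / 2 = ((x + L.ω₂.re / 2 : ℝ) : ℂ) + y * Complex.I :=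
      fun x ↦ by
    apply Complex.ext <;> simp [hy]
  have hconth : Continuous fun x : ℝ ↦ ψ (x + L.ω₂ / 2) := by
    simp only [hhalf]
    exact hcontψ.comp (continuous_add_const (L.ω₂.re / 2))
  have hinth : ∫ x : ℝ in (-1 / 2)..(1 / 2), ψ (x + L.ω₂ / 2) = -(Real.pi * Complex.I) := by
    simp only [hhalf]
    rw [intervalIntegral.integral_comp_add_right fun x : ℝ ↦ ψ (x + y * Complex.I), ← hint]
    -- The horizontal shift by `Re ω₂ / 2` does not change an integral over a full period.
    have := hper.intervalIntegral_add_eq (-1 / 2 + L.ω₂.re / 2) (-1 / 2)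
    convert this using 2 <;> ring
  have hodd : ∀ z, ψ (-z) = -ψ z := fun z ↦ by
    simp only [hψ, weierstrassZeta_neg]
    ring
  have hinth' : ∫ x : ℝ in (-1 / 2)..(1 / 2), ψ (((-x : ℝ) : ℂ) + L.ω₂ / 2) =
      -(Real.pi * Complex.I) := by
    rw [intervalIntegral.integral_comp_neg fun x : ℝ ↦ ψ (x + L.ω₂ / 2), ← hinth]
    congr 1 <;> norm_num
  have hjump : ∀ x : ℝ, ψ (x + L.ω₂ / 2) + ψ (((-x : ℝ) : ℂ) + L.ω₂ / 2) =
      L.quasiPeriod L.ω₂ - L.eta₁ * L.ω₂ := fun x ↦ by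
    have hm : ((-x : ℝ) : ℂ) + L.ω₂ / 2 ∉ L.lattice := by
      rw [hhalf]
      exact hmem _
    have := L.weierstrassZeta_add (z := -(((-x : ℝ) : ℂ) + L.ω₂ / 2)) L.ω₂_mem_lattice
      (by rwa [Submodule.neg_mem_iff])
    rw [weierstrassZeta_neg] at this
    have e : -(((-x : ℝ) : ℂ) + L.ω₂ / 2) + L.ω₂ = x + L.ω₂ / 2 := by
      push_cast
      ring
    rw [e] at this
    simp only [hψ]
    rw [this]
    push_cast
    ring
  have hsum := intervalIntegral.integral_add (μ := MeasureTheory.volume)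
    (hconth.intervalIntegrable (-1 / 2) (1 / 2))
    ((hconth.comp continuous_neg).intervalIntegrable (-1 / 2) (1 / 2))
  simp only [Function.comp_def] at hsum
  rw [hinth, hinth', intervalIntegral.integral_congr fun x _ ↦ hjump x,
    intervalIntegral.integral_const] at hsum
  norm_num at hsum
  linear_combination -hsum

end PeriodPair

/-! ### Holomorphy and poles of the parameter derivative -/

section ParameterDerivative

variable {f : ℝ → ℂ → ℂ} {U : Set (ℝ × ℂ)}

/-- The derivative of a family of functions with respect to its real parameter. -/
noncomputable def paramDeriv (f : ℝ → ℂ → ℂ) (t : ℝ) (z : ℂ) : ℂ := deriv (fun s ↦ f s z) t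

lemma paramDeriv_eq_fderiv {t : ℝ} {z : ℂ}
    (hf : DifferentiableAt ℝ (fun p : ℝ × ℂ ↦ f p.1 p.2) (t, z)) :
    paramDeriv f t z = fderiv ℝ (fun p : ℝ × ℂ ↦ f p.1 p.2) (t, z) (1, 0) := by
  have := hf.hasFDerivAt.comp_hasDerivAt t ((hasDerivAt_id t).prodMk (hasDerivAt_const t z))
  exact this.deriv

lemma fderiv_apply_zero_prod {t : ℝ} {z : ℂ}
    (hf : DifferentiableAt ℝ (fun p : ℝ × ℂ ↦ f p.1 p.2) (t, z))
    (hz : DifferentiableAt ℂ (f t) z) (v : ℂ) :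
    fderiv ℝ (fun p : ℝ × ℂ ↦ f p.1 p.2) (t, z) (0, v) = deriv (f t) z * v := by
  have h1 := hf.hasFDerivAt.comp z ((hasFDerivAt_const t z).prodMk (hasFDerivAt_id z))
  have h2 := hz.hasDerivAt.hasFDerivAt.restrictScalars ℝ
  have := DFunLike.congr_fun (h1.unique h2) v
  simpa [mul_comm] using this

lemma hasDerivAt_family_along_curve {t : ℝ} {z : ℝ → ℂ} {z' : ℂ}
    (hf : DifferentiableAt ℝ (fun p : ℝ × ℂ ↦ f p.1 p.2) (t, z t))
    (hz : DifferentiableAt ℂ (f t) (z t)) (hz' : HasDerivAt z z' t) :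
    HasDerivAt (fun s ↦ f s (z s)) (paramDeriv f t (z t) + deriv (f t) (z t) * z') t := by
  have := hf.hasFDerivAt.comp_hasDerivAt t ((hasDerivAt_id t).prodMk hz')
  refine this.congr_deriv ?_
  rw [paramDeriv_eq_fderiv hf, ← fderiv_apply_zero_prod hf hz, ← map_add]
  simp

lemma contDiffAt_of_mem (hU : IsOpen U) (hf : ContDiffOn ℝ 1 (fun p : ℝ × ℂ ↦ f p.1 p.2) U)
    {p : ℝ × ℂ} (hp : p ∈ U) : ContDiffAt ℝ 1 (fun p : ℝ × ℂ ↦ f p.1 p.2) p :=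
  hf.contDiffAt (hU.mem_nhds hp)

lemma differentiableAt_of_mem (hU : IsOpen U)
    (hf : ContDiffOn ℝ 1 (fun p : ℝ × ℂ ↦ f p.1 p.2) U)
    {p : ℝ × ℂ} (hp : p ∈ U) : DifferentiableAt ℝ (fun p : ℝ × ℂ ↦ f p.1 p.2) p :=
  (contDiffAt_of_mem hU hf hp).differentiableAt (by simp)

lemma hasDerivAt_paramDeriv (hU : IsOpen U)
    (hf : ContDiffOn ℝ 1 (fun p : ℝ × ℂ ↦ f p.1 p.2) U) {t : ℝ} {z : ℂ} (hp : (t, z) ∈ U) :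
    HasDerivAt (fun s ↦ f s z) (paramDeriv f t z) t := by
  have := (differentiableAt_of_mem hU hf hp).hasFDerivAt.comp_hasDerivAt t
    ((hasDerivAt_id t).prodMk (hasDerivAt_const t z))
  rw [paramDeriv_eq_fderiv (differentiableAt_of_mem hU hf hp)]
  exact this

lemma continuousAt_paramDeriv (hU : IsOpen U)
    (hf : ContDiffOn ℝ 1 (fun p : ℝ × ℂ ↦ f p.1 p.2) U) {p : ℝ × ℂ} (hp : p ∈ U) :
    ContinuousAt (fun p : ℝ × ℂ ↦ paramDeriv f p.1 p.2) p := by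
  have h := ((contDiffAt_of_mem hU hf hp).fderiv_right (m := 0) (by simp)).continuousAt
  have h' : ContinuousAt (fun q ↦ fderiv ℝ (fun p : ℝ × ℂ ↦ f p.1 p.2) q (1, 0)) p :=
    h.clm_apply continuousAt_const
  refine h'.congr ?_
  filter_upwards [hU.mem_nhds hp] with q hq
  exact (paramDeriv_eq_fderiv (differentiableAt_of_mem hU hf hq)).symm

/-- Strict differentiability, available from `C¹`, lets the base point move along with the
increment; this joint limit is what locally uniform convergence needs. -/
lemma tendsto_difference_quotient (hU : IsOpen U)
    (hf : ContDiffOn ℝ 1 (fun p : ℝ × ℂ ↦ f p.1 p.2) U) {t : ℝ} {z : ℂ} (hp : (t, z) ∈ U) :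
    Tendsto (fun q : ℝ × ℂ ↦ (q.1 : ℂ)⁻¹ * (f (t + q.1) q.2 - f t q.2)) (𝓝[≠] 0 ×ˢ 𝓝 z)
      (𝓝 (paramDeriv f t z)) := by
  have h := (contDiffAt_of_mem hU hf hp).hasStrictFDerivAt one_ne_zero
  rw [hasStrictFDerivAt_iff_isLittleO] at h
  have ht : Tendsto (fun q : ℝ × ℂ ↦ ((t + q.1, q.2), (t, q.2))) (𝓝[≠] 0 ×ˢ 𝓝 z)
      (𝓝 ((t, z), (t, z))) := by
    have hc : Continuous fun q : ℝ × ℂ ↦ ((t + q.1, q.2), (t, q.2)) := by fun_prop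
    have := hc.tendsto (0, z)
    rw [add_zero, nhds_prod_eq] at this
    exact this.mono_left (Filter.prod_mono nhdsWithin_le_nhds le_rfl)
  have h' := h.comp_tendsto ht
  rw [tendsto_iff_norm_sub_tendsto_zero]
  have h'' := (h'.norm_norm).tendsto_div_nhds_zero
  refine h''.congr' ?_
  have hne : ∀ᶠ q : ℝ × ℂ in 𝓝[≠] 0 ×ˢ 𝓝 z, q.1 ≠ 0 :=
    tendsto_fst.eventually self_mem_nhdsWithin
  filter_upwards [hne] with q hq
  have hq' : (q.1 : ℂ) ≠ 0 := by exact_mod_cast hq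
  simp only [Function.comp_apply, Prod.mk_sub_mk, add_sub_cancel_left, sub_self]
  have e1 : fderiv ℝ (fun p : ℝ × ℂ ↦ f p.1 p.2) (t, z) (q.1, 0) = q.1 * paramDeriv f t z := by
    rw [paramDeriv_eq_fderiv (differentiableAt_of_mem hU hf hp)]
    have : ((q.1, 0) : ℝ × ℂ) = q.1 • (1, 0) := by simp
    rw [this, map_smul]
    simp
  rw [e1, Prod.norm_mk, norm_zero, max_eq_left (norm_nonneg _), div_eq_iff (norm_ne_zero_iff.2 hq),
    ← Complex.norm_real, ← norm_mul]
  congr 1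
  field_simp

/-- If a family of holomorphic functions is jointly `C¹`, its parameter derivative is
holomorphic. -/
lemma analyticAt_paramDeriv (hU : IsOpen U)
    (hf : ContDiffOn ℝ 1 (fun p : ℝ × ℂ ↦ f p.1 p.2) U)
    (hol : ∀ p ∈ U, DifferentiableAt ℂ (f p.1) p.2) {t : ℝ} {z : ℂ} (hp : (t, z) ∈ U) :
    AnalyticAt ℂ (paramDeriv f t) z := by
  obtain ⟨A, hA, B, hB, hAB⟩ := mem_nhds_prod_iff.1 (hU.mem_nhds hp)
  obtain ⟨V, hVB, hV, hzV⟩ := mem_nhds_iff.1 hB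
  have htA := mem_of_mem_nhds hA
  suffices h : DifferentiableOn ℂ (paramDeriv f t) V from h.analyticAt (hV.mem_nhds hzV)
  -- The parameter derivative is a locally uniform limit of difference quotients that are
  -- holomorphic in `w`.
  refine TendstoLocallyUniformlyOn.differentiableOn (φ := 𝓝[≠] (0 : ℝ))
    (F := fun h w ↦ (h : ℂ)⁻¹ * (f (t + h) w - f t w)) ?_ ?_ hV
  · rw [tendstoLocallyUniformlyOn_iff_forall_tendsto]
    intro x hx
    have hxU : (t, x) ∈ U := hAB ⟨htA, hVB hx⟩
    have h1 := (tendsto_difference_quotient hU hf hxU).mono_left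
      (Filter.prod_mono le_rfl (nhdsWithin_le_nhds (s := V)))
    have hc : ContinuousAt (paramDeriv f t) x :=
      ContinuousAt.comp (f := fun w : ℂ ↦ (t, w)) (continuousAt_paramDeriv hU hf hxU)
        (by fun_prop)
    have h2 : Tendsto (fun q : ℝ × ℂ ↦ paramDeriv f t q.2) (𝓝[≠] 0 ×ˢ 𝓝[V] x)
        (𝓝 (paramDeriv f t x)) :=
      hc.tendsto.comp (tendsto_snd.mono_right nhdsWithin_le_nhds)
    refine Tendsto.mono_right (h2.prodMk_nhds h1) (nhds_le_uniformity _)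
  · have hA' : ∀ᶠ h in 𝓝[≠] (0 : ℝ), t + h ∈ A := by
      refine Filter.Eventually.filter_mono nhdsWithin_le_nhds ?_
      have : Tendsto (fun h : ℝ ↦ t + h) (𝓝 0) (𝓝 t) := by
        simpa using (continuous_const_add t).tendsto (0 : ℝ)
      exact this hA
    filter_upwards [hA'] with h hh w hw
    exact ((differentiableAt_const _).mul ((hol (t + h, w) (hAB ⟨hh, hVB hw⟩)).sub
      (hol (t, w) (hAB ⟨htA, hVB hw⟩)))).differentiableWithinAt

lemma exists_diffContOnCl_extension {u : ℂ → ℂ} {r : ℝ} (hr : 0 < r)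
    (h0 : HasAnalyticExtensionAt u 0) (hd : ∀ z, z ≠ 0 → ‖z‖ ≤ r → DifferentiableAt ℂ u z) :
    ∃ g, (∀ z, z ≠ 0 → g z = u z) ∧ DiffContOnCl ℂ g (Metric.ball 0 r) := by
  obtain ⟨g, hg, hug⟩ := h0
  have hne : ∀ z ≠ 0, Function.update u 0 (g 0) z = u z := fun z hz ↦ Function.update_of_ne hz _ _
  refine ⟨Function.update u 0 (g 0), hne, DifferentiableOn.diffContOnCl fun z hz ↦ ?_⟩
  rw [closure_ball _ hr.ne', mem_closedBall_zero_iff] at hz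
  refine DifferentiableAt.differentiableWithinAt ?_
  rcases eq_or_ne z 0 with rfl | hz0
  · refine hg.differentiableAt.congr_of_eventuallyEq
      (eventuallyEq_nhds_of_eventuallyEq_nhdsNE ?_ (Function.update_self ..))
    filter_upwards [hug, self_mem_nhdsWithin] with w hw hw0
    rw [hne w hw0, hw]
  · refine (hd z hz0 hz).congr_of_eventuallyEq ?_
    filter_upwards [isOpen_ne.mem_nhds hz0] with w hw using hne w hw

/-- If the members of a `C¹` family of functions have a pole of order at most `n` at the origin,
then so does the parameter derivative. -/
lemma hasAnalyticExtensionAt_pow_mul_paramDeriv (hU : IsOpen U)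
    (hf : ContDiffOn ℝ 1 (fun p : ℝ × ℂ ↦ f p.1 p.2) U)
    (hol : ∀ p ∈ U, DifferentiableAt ℂ (f p.1) p.2) {t : ℝ}
    (hU0 : ∀ᶠ p in 𝓝 (t, (0 : ℂ)), p.2 ≠ 0 → p ∈ U) (n : ℕ)
    (hpole : ∀ᶠ s in 𝓝 t, HasAnalyticExtensionAt (fun z ↦ z ^ n * f s z) 0) :
    HasAnalyticExtensionAt (fun z ↦ z ^ n * paramDeriv f t z) 0 := by
  obtain ⟨δ, hδ, hball⟩ := Metric.eventually_nhds_iff_ball.1 hU0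
  obtain ⟨δ', hδ', hpole'⟩ := Metric.eventually_nhds_iff_ball.1 hpole
  set r := min δ δ' / 2 with hr
  have hr0 : 0 < r := by positivity
  have hrδ : r < δ := by
    have := min_le_left δ δ'
    linarith [lt_min hδ hδ']
  have hrδ' : r < δ' := by
    have := min_le_right δ δ'
    linarith [lt_min hδ hδ']
  have hmem : ∀ s ∈ Set.Icc (t - r) (t + r), ∀ z : ℂ, z ≠ 0 → ‖z‖ ≤ r → (s, z) ∈ U := by
    intro s hs z hz hzr
    refine hball (s, z) ?_ hz
    rw [← ball_prod_same]
    refine ⟨?_, by simpa using hzr.trans_lt hrδ⟩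
    rw [Metric.mem_ball, Real.dist_eq]
    exact (abs_le.2 ⟨by linarith [hs.1], by linarith [hs.2]⟩ : |s - t| ≤ r).trans_lt hrδ
  have hpole'' : ∀ s ∈ Set.Icc (t - r) (t + r),
      HasAnalyticExtensionAt (fun z ↦ z ^ n * f s z) 0 := fun s hs ↦ by
    refine hpole' s ?_
    rw [Metric.mem_ball, Real.dist_eq]
    exact (abs_le.2 ⟨by linarith [hs.1], by linarith [hs.2]⟩ : |s - t| ≤ r).trans_lt hrδ'
  have htI : t ∈ Set.Icc (t - r) (t + r) := ⟨by linarith, by linarith⟩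
  -- The bound is taken on a circle around the pole, uniformly for parameters in a compact interval.
  obtain ⟨M, hM⟩ := ((isCompact_Icc (a := t - r) (b := t + r)).prod
    (isCompact_sphere (0 : ℂ) r)).exists_bound_of_continuousOn
    (f := fun p : ℝ × ℂ ↦ p.2 ^ n * paramDeriv f p.1 p.2) fun p hp ↦ by
      have hp2 : ‖p.2‖ = r := by simpa using hp.2
      refine ContinuousAt.continuousWithinAt ?_
      exact (continuousAt_snd.pow n).mul (continuousAt_paramDeriv hU hf
        (hmem p.1 hp.1 p.2 (norm_pos_iff.1 (hp2 ▸ hr0)) hp2.le))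
  have hsphere : ∀ s ∈ Set.Icc (t - r) (t + r), ∀ z : ℂ, ‖z‖ = r →
      ‖z ^ n * f s z - z ^ n * f t z‖ ≤ M * ‖s - t‖ := by
    intro s hs z hz
    refine Convex.norm_image_sub_le_of_norm_hasDerivWithin_le (𝕜 := ℝ)
      (f := fun s ↦ z ^ n * f s z) (f' := fun s ↦ z ^ n * paramDeriv f s z)
      (fun x hx ↦ ?_) (fun x hx ↦ hM (x, z) ⟨hx, by simpa using hz⟩) (convex_Icc _ _) htI hs
    exact ((hasDerivAt_paramDeriv hU hf
      (hmem x hx z (norm_pos_iff.1 (hz ▸ hr0)) hz.le)).const_mul _).hasDerivWithinAt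
  have hM0 : 0 ≤ M := (norm_nonneg _).trans (hM (t, (r : ℂ)) ⟨htI, by simp [abs_of_pos hr0]⟩)
  -- After the pole is cleared by `z ^ n`, the maximum principle carries the Lipschitz bound in `s`
  -- from the circle to the whole disc.
  have hdisc : ∀ s ∈ Set.Icc (t - r) (t + r), ∀ z : ℂ, z ≠ 0 → ‖z‖ ≤ r →
      ‖z ^ n * f s z - z ^ n * f t z‖ ≤ M * ‖s - t‖ := by
    intro s hs z hz hzr
    obtain ⟨g, hg, hgd⟩ := exists_diffContOnCl_extension hr0 ((hpole'' s hs).sub (hpole'' t htI))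
      fun w hw hwr ↦ ((differentiableAt_id.pow n).mul (hol _ (hmem s hs w hw hwr))).sub
        ((differentiableAt_id.pow n).mul (hol _ (hmem t htI w hw hwr)))
    rw [← hg z hz]
    refine Complex.norm_le_of_forall_mem_frontier_norm_le Metric.isBounded_ball hgd
      (fun w hw ↦ ?_) (by rw [closure_ball _ hr0.ne']; simpa using hzr)
    rw [frontier_ball _ hr0.ne', mem_sphere_zero_iff_norm] at hw
    rw [hg w (norm_pos_iff.1 (hw ▸ hr0))]
    exact hsphere s hs w hw
  have hbound : ∀ z : ℂ, z ≠ 0 → ‖z‖ ≤ r → ‖z ^ n * paramDeriv f t z‖ ≤ M := fun z hz hzr ↦ by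
    refine ((hasDerivAt_paramDeriv hU hf (hmem t htI z hz hzr)).const_mul (z ^ n)).le_of_lip' hM0 ?_
    filter_upwards [Icc_mem_nhds (by linarith : t - r < t) (by linarith : t < t + r)] with s hs
    exact hdisc s hs z hz hzr
  -- The Lipschitz constant bounds the derivative in `s`, so Riemann's removable singularity theorem
  -- applies.
  have := Complex.differentiableOn_update_limUnder_of_bddAbove (c := (0 : ℂ))
    (f := fun z ↦ z ^ n * paramDeriv f t z) (Metric.ball_mem_nhds 0 hr0) (fun z hz ↦ ?_)
    ⟨M, ?_⟩
  · refine ⟨_, this.analyticAt (Metric.ball_mem_nhds 0 hr0), ?_⟩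
    filter_upwards [self_mem_nhdsWithin] with z hz
    rw [Function.update_of_ne (show z ≠ 0 from hz)]
  · have hzr : ‖z‖ < r := by simpa using hz.1
    exact ((differentiableAt_id.pow n).mul (analyticAt_paramDeriv hU hf hol
      (hmem t htI z hz.2 hzr.le)).differentiableAt).differentiableWithinAt
  · rintro _ ⟨z, hz, rfl⟩
    have hzr : ‖z‖ < r := by simpa using hz.1
    exact hbound z hz.2 hzr.le

end ParameterDerivative

/-! ### Generic points and lattice coordinates -/

namespace PeriodPair

variable (L : PeriodPair)

lemma eventually_sub_notMem_lattice (z₀ a : ℂ) : ∀ᶠ z in 𝓝[≠] z₀, z - a ∉ L.lattice := by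
  have h := L.compl_lattice_sdiff_singleton_mem_nhds (z₀ - a)
  have hc : Tendsto (fun z ↦ z - a) (𝓝[≠] z₀) (𝓝 (z₀ - a)) :=
    ((continuous_id.sub continuous_const).tendsto z₀).mono_left nhdsWithin_le_nhds
  filter_upwards [hc h, self_mem_nhdsWithin] with z hz hne hmem
  exact hz ⟨hmem, fun h ↦ hne (sub_left_injective h)⟩

lemma eventually_notMem_lattice (z₀ : ℂ) : ∀ᶠ z in 𝓝[≠] z₀, z ∉ L.lattice := by
  simpa using L.eventually_sub_notMem_lattice z₀ 0

lemma eventually_generic {ι : Type*} [Finite ι] (b : ι → ℂ) (z₀ : ℂ) :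
    ∀ᶠ z in 𝓝[≠] z₀, z ∉ L.lattice ∧ ∀ k, z - b k ∉ L.lattice :=
  (L.eventually_notMem_lattice z₀).and
    (eventually_all.2 fun k ↦ L.eventually_sub_notMem_lattice z₀ (b k))

/-- In real coordinates with respect to `1, ω₂` the lattice becomes the fixed closed set `ℤ × ℤ`;
since the coordinates vary continuously with `t`, the domain of the family is open. -/
lemma notMem_lattice_iff_of_one (h₁ : L.ω₁ = 1) (h₂ : 0 < L.ω₂.im) (z : ℂ) :
    z ∉ L.lattice ↔ (z.re - z.im / L.ω₂.im * L.ω₂.re, z.im / L.ω₂.im) ∈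
      ((Set.range ((↑) : ℤ → ℝ)) ×ˢ (Set.range ((↑) : ℤ → ℝ)))ᶜ := by
  rw [Set.mem_compl_iff, not_iff_not, mem_lattice, Set.mem_prod]
  constructor
  · rintro ⟨m, k, rfl⟩
    have : (m * L.ω₁ + k * L.ω₂).im / L.ω₂.im = k := by
      simp [h₁, h₂.ne']
    rw [this]
    exact ⟨⟨m, by simp [h₁]⟩, ⟨k, rfl⟩⟩
  · rintro ⟨⟨m, hm⟩, ⟨k, hk⟩⟩
    simp only at hm hk
    refine ⟨m, k, ?_⟩
    rw [← hk] at hm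
    rw [eq_div_iff h₂.ne'] at hk
    apply Complex.ext
    · simp [h₁]
      linarith
    · simp [h₁]
      linarith

end PeriodPair

lemma isClosed_range_intCast_prod :
    IsClosed ((Set.range ((↑) : ℤ → ℝ)) ×ˢ (Set.range ((↑) : ℤ → ℝ))) :=
  Int.isClosedEmbedding_coe_real.isClosed_range.prod Int.isClosedEmbedding_coe_real.isClosed_range

/-! ### Local behaviour and periodicity of the family -/

namespace IsSmoothEllipticFamily

variable {n : ℕ} {I : Set ℝ} {L : ℝ → PeriodPair} {f : ℝ → ℂ → ℂ} {a : Fin (n + 1) → ℝ → ℂ}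
  (hf : IsSmoothEllipticFamily n I L f a)
include hf

lemma continuousOn_latticeCoordinates :
    ContinuousOn (fun p : ℝ × ℂ ↦ (p.2.re - p.2.im / ((L p.1).ω₂).im * ((L p.1).ω₂).re,
      p.2.im / ((L p.1).ω₂).im)) (I ×ˢ Set.univ) := by
  have h2 : ContinuousOn (fun p : ℝ × ℂ ↦ (L p.1).ω₂) (I ×ˢ Set.univ) :=
    hf.smooth_period.continuousOn.comp continuousOn_fst fun p hp ↦ hp.1
  have him := Complex.continuous_im.comp_continuousOn h2
  have hre := Complex.continuous_re.comp_continuousOn h2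
  have hne : ∀ p ∈ I ×ˢ (Set.univ : Set ℂ), ((L p.1).ω₂).im ≠ 0 :=
    fun p hp ↦ (hf.period_two_im_pos p.1 hp.1).ne'
  have hz : ContinuousOn (fun p : ℝ × ℂ ↦ p.2.im / ((L p.1).ω₂).im) (I ×ˢ Set.univ) :=
    (Complex.continuous_im.comp continuous_snd).continuousOn.div him hne
  exact ((Complex.continuous_re.comp continuous_snd).continuousOn.sub (hz.mul hre)).prodMk hz

lemma isOpen_domain : IsOpen {p : ℝ × ℂ | p.1 ∈ I ∧ p.2 ∉ (L p.1).lattice} := by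
  have := hf.continuousOn_latticeCoordinates.isOpen_inter_preimage (hf.isOpen.prod isOpen_univ)
    isClosed_range_intCast_prod.isOpen_compl
  convert this using 1
  ext p
  simp only [Set.mem_ofPred_eq, Set.mem_inter_iff, Set.mem_prod, Set.mem_univ, and_true,
    Set.mem_preimage]
  exact and_congr_right fun hp ↦ (L p.1).notMem_lattice_iff_of_one (hf.period_one _ hp)
    (hf.period_two_im_pos _ hp) p.2

lemma eventually_mem_domain {t : ℝ} (ht : t ∈ I) :
    ∀ᶠ p in 𝓝 (t, (0 : ℂ)), p.2 ≠ 0 → p ∈ {p : ℝ × ℂ | p.1 ∈ I ∧ p.2 ∉ (L p.1).lattice} := by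
  have hI : I ×ˢ (Set.univ : Set ℂ) ∈ 𝓝 (t, (0 : ℂ)) :=
    (hf.isOpen.prod isOpen_univ).mem_nhds ⟨ht, trivial⟩
  have hc := hf.continuousOn_latticeCoordinates.continuousAt hI
  have h0 : Metric.ball (0 : ℝ × ℝ) 1 ∈ 𝓝 ((0 : ℝ × ℝ)) := Metric.ball_mem_nhds _ one_pos
  have := hc.tendsto
  simp only [Complex.zero_re, Complex.zero_im, zero_div, zero_mul, sub_zero] at this
  filter_upwards [this h0, hI] with p hp hpI hp0
  refine ⟨hpI.1, fun hmem ↦ hp0 ?_⟩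
  obtain ⟨m, k, h⟩ := PeriodPair.mem_lattice.1 hmem
  have h2 := hf.period_two_im_pos _ hpI.1
  have him : p.2.im = k * ((L p.1).ω₂).im := by rw [← h]; simp [hf.period_one _ hpI.1]
  have hre : p.2.re = m + k * ((L p.1).ω₂).re := by rw [← h]; simp [hf.period_one _ hpI.1]
  rw [Set.mem_preimage, mem_ball_zero_iff, Prod.norm_def, max_lt_iff, him, hre,
    mul_div_cancel_right₀ _ h2.ne', add_sub_cancel_right, Real.norm_eq_abs, Real.norm_eq_abs] at hp
  have hk : k = 0 := Int.abs_lt_one_iff.1 (by exact_mod_cast (show |(k : ℝ)| < 1 from hp.2))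
  have hm : m = 0 := Int.abs_lt_one_iff.1 (by exact_mod_cast (show |(m : ℝ)| < 1 from hp.1))
  rw [← h, hk, hm]
  simp

lemma eventually_mem {t : ℝ} (ht : t ∈ I) : ∀ᶠ s in 𝓝 t, s ∈ I := hf.isOpen.mem_nhds ht

lemma analyticAt {t : ℝ} (ht : t ∈ I) {z : ℂ} (hz : z ∉ (L t).lattice) : AnalyticAt ℂ (f t) z :=
  (hf.holomorphic t ht).analyticAt ((L t).isOpen_compl_lattice.mem_nhds hz)

lemma differentiableAt_of_mem_domain :
    ∀ p ∈ {p : ℝ × ℂ | p.1 ∈ I ∧ p.2 ∉ (L p.1).lattice}, DifferentiableAt ℂ (f p.1) p.2 :=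
  fun _ hp ↦ (hf.analyticAt hp.1 hp.2).differentiableAt

lemma add_lattice {t : ℝ} (ht : t ∈ I) {l : ℂ} (hl : l ∈ (L t).lattice) {z : ℂ}
    (hz : z ∉ (L t).lattice) : f t (z + l) = f t z := by
  classical
  -- Periodicity is only known off the lattice; resetting the values on the lattice to 0 makes it
  -- hold everywhere.
  have hg := (L t).apply_add_of_mem_lattice (G := fun z ↦ if z ∈ (L t).lattice then 0 else f t z)
    (fun z ↦ ?_) (fun z ↦ ?_) hl z
  · simpa [(L t).add_notMem_lattice hl hz, hz] using hg
  · simp only [Submodule.add_mem_iff_left _ (L t).ω₁_mem_lattice]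
    split_ifs with h
    exacts [rfl, hf.periodic_one t ht z h]
  · simp only [Submodule.add_mem_iff_left _ (L t).ω₂_mem_lattice]
    split_ifs with h
    exacts [rfl, hf.periodic_two t ht z h]

lemma deriv_add_lattice {t : ℝ} (ht : t ∈ I) {l : ℂ} (hl : l ∈ (L t).lattice) {z : ℂ}
    (hz : z ∉ (L t).lattice) : deriv (f t) (z + l) = deriv (f t) z := by
  rw [← deriv_comp_add_const]
  refine Filter.EventuallyEq.deriv_eq ?_
  filter_upwards [(L t).isOpen_compl_lattice.mem_nhds hz] with w hw using hf.add_lattice ht hl hw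

lemma hasAnalyticExtensionAt_pow_mul {t : ℝ} (ht : t ∈ I) :
    HasAnalyticExtensionAt (fun z ↦ z ^ n * f t z) 0 := by
  obtain ⟨g, hg, -, hfg⟩ :=
    (meromorphicOrderAt_eq_int_iff (hf.meromorphicAt_zero t ht)).1 (hf.order_zero t ht)
  refine ⟨g, hg, ?_⟩
  filter_upwards [hfg, self_mem_nhdsWithin] with z hz hz0
  have hz0' : z ≠ 0 := hz0
  rw [hz, sub_zero, zpow_neg, zpow_natCast, smul_eq_mul, mul_inv_cancel_left₀ (pow_ne_zero _ hz0')]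

/-- From `f = z⁻ⁿ g` one gets `z^{n+1} f' = z g' - n g`, with value `-n g(0) ≠ 0` at the origin: the
pole of `f'` has order exactly `n + 1`. -/
lemma exists_pow_mul_deriv_eq {t : ℝ} (ht : t ∈ I) :
    ∃ w : ℂ → ℂ, AnalyticAt ℂ w 0 ∧ w 0 ≠ 0 ∧
      (fun z ↦ z ^ (n + 1) * deriv (f t) z) =ᶠ[𝓝[≠] 0] w := by
  obtain ⟨g, hg, hg0, hfg⟩ :=
    (meromorphicOrderAt_eq_int_iff (hf.meromorphicAt_zero t ht)).1 (hf.order_zero t ht)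
  have hn : n ≠ 0 := by linarith [hf.two_le]
  refine ⟨fun z ↦ z * deriv g z - n * g z, ?_, by simp [hn, hg0], ?_⟩
  · exact (analyticAt_id.mul hg.deriv).sub (analyticAt_const.mul hg)
  · filter_upwards [eventually_eventually_nhdsWithin.2 hfg, self_mem_nhdsWithin,
      hg.eventually_analyticAt.filter_mono nhdsWithin_le_nhds] with z hz hz0 hgz
    have hz0' : z ≠ 0 := hz0
    rw [isOpen_compl_singleton.nhdsWithin_eq hz0] at hz
    have hd := ((hasDerivAt_zpow (-(n : ℤ)) z (Or.inl hz0')).mul hgz.differentiableAt.hasDerivAt)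
    have he : f t =ᶠ[𝓝 z] fun z ↦ z ^ (-(n : ℤ)) * g z := by
      filter_upwards [hz] with w hw
      rw [hw, sub_zero, smul_eq_mul]
    rw [(hd.congr_of_eventuallyEq he).deriv, zpow_sub_one₀ hz0', zpow_neg, zpow_natCast, pow_succ]
    push_cast
    field_simp
    ring

/-- In the chain rule the term `f'(a_k) ȧ_k` drops out because `a_k` is critical. -/
lemma paramDeriv_crit {t : ℝ} (ht : t ∈ I) (k : Fin (n + 1)) :
    HasDerivAt (critValue f a k) (paramDeriv f t (a k t)) t := by
  have hm := hf.crit_notMem t ht k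
  have hk := ((hf.smooth_crit k).contDiffAt (hf.isOpen.mem_nhds ht)).differentiableAt
    (by simp) |>.hasDerivAt
  have := hasDerivAt_family_along_curve
    (differentiableAt_of_mem hf.isOpen_domain hf.smooth (p := (t, a k t)) ⟨ht, hm⟩)
    (hf.analyticAt ht hm).differentiableAt hk
  rw [hf.crit t ht k, zero_mul, add_zero] at this
  exact this

lemma critGamma_eq {t : ℝ} (ht : t ∈ I) (k : Fin (n + 1)) :
    critGamma f a k t = paramDeriv f t (a k t) / deriv (deriv (f t)) (a k t) := by
  rw [critGamma, (hf.paramDeriv_crit ht k).deriv, critD]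

lemma critGamma_zero {t : ℝ} (ht : t ∈ I) : critGamma f a 0 t = 0 := by
  have : critValue f a 0 =ᶠ[𝓝 t] fun _ ↦ 0 := by
    filter_upwards [hf.eventually_mem ht] with s hs using hf.critValue_zero s hs
  rw [critGamma, this.deriv_eq, deriv_const, zero_div]

lemma hasDerivAt_period {t : ℝ} (ht : t ∈ I) :
    HasDerivAt (fun s ↦ (L s).ω₂) (deriv (fun s ↦ (L s).ω₂) t) t :=
  ((hf.smooth_period.contDiffAt (hf.isOpen.mem_nhds ht)).differentiableAt (by simp)).hasDerivAt

/-- Differentiate `f(z + mω₁ + kω₂(s), s) = f(z, s)` at `s = t`; the period `ω₁ = 1` contributes no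
velocity. -/
lemma paramDeriv_add_lattice {t : ℝ} (ht : t ∈ I) (m k : ℤ) {z : ℂ} (hz : z ∉ (L t).lattice) :
    paramDeriv f t (z + (m * (L t).ω₁ + k * (L t).ω₂)) =
      paramDeriv f t z - k * deriv (fun s ↦ (L s).ω₂) t * deriv (f t) z := by
  have hl : ∀ s, m * (L s).ω₁ + k * (L s).ω₂ ∈ (L s).lattice := fun s ↦
    PeriodPair.mem_lattice.2 ⟨m, k, rfl⟩
  have hz' := (L t).add_notMem_lattice (hl t) hz
  have hcurve : HasDerivAt (fun s ↦ z + (m * (L s).ω₁ + k * (L s).ω₂))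
      (k * deriv (fun s ↦ (L s).ω₂) t) t := by
    have h := (((hf.hasDerivAt_period ht).const_mul (k : ℂ)).const_add (m : ℂ)).const_add z
    refine h.congr_of_eventuallyEq ?_
    filter_upwards [hf.eventually_mem ht] with s hs
    rw [hf.period_one s hs, mul_one]
  have h1 := hasDerivAt_family_along_curve
    (differentiableAt_of_mem hf.isOpen_domain hf.smooth ⟨ht, hz'⟩)
    (hf.analyticAt ht hz').differentiableAt hcurve
  have h2 : HasDerivAt (fun s ↦ f s (z + (m * (L s).ω₁ + k * (L s).ω₂))) (paramDeriv f t z) t := by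
    refine (hasDerivAt_paramDeriv hf.isOpen_domain hf.smooth (z := z)
      ⟨ht, hz⟩).congr_of_eventuallyEq ?_
    have : ∀ᶠ s in 𝓝 t, s ∈ I ∧ z ∉ (L s).lattice :=
      (by fun_prop : ContinuousAt (fun s : ℝ ↦ (s, z)) t) (hf.isOpen_domain.mem_nhds ⟨ht, hz⟩)
    filter_upwards [this] with s hs using hf.add_lattice hs.1 (hl s) hs.2
  rw [hf.deriv_add_lattice ht (hl t) hz] at h1
  rw [← h1.unique h2]
  ring

lemma hasAnalyticExtensionAt_pow_mul_paramDeriv {t : ℝ} (ht : t ∈ I) :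
    HasAnalyticExtensionAt (fun z ↦ z ^ n * paramDeriv f t z) 0 :=
  _root_.hasAnalyticExtensionAt_pow_mul_paramDeriv hf.isOpen_domain hf.smooth
    hf.differentiableAt_of_mem_domain (hf.eventually_mem_domain ht) n
    ((hf.eventually_mem ht).mono fun _ hs ↦ hf.hasAnalyticExtensionAt_pow_mul hs)

lemma analyticAt_paramDeriv {t : ℝ} (ht : t ∈ I) {z : ℂ} (hz : z ∉ (L t).lattice) :
    AnalyticAt ℂ (paramDeriv f t) z :=
  _root_.analyticAt_paramDeriv hf.isOpen_domain hf.smooth hf.differentiableAt_of_mem_domain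
    ⟨ht, hz⟩

lemma deriv_ne_zero {t : ℝ} (ht : t ∈ I) {z : ℂ} (hz : z ∉ (L t).lattice)
    (hza : ∀ k, z - a k t ∉ (L t).lattice) : deriv (f t) z ≠ 0 := fun h ↦ by
  obtain ⟨k, hk⟩ := hf.crit_complete t ht z hz h
  exact hza k hk

end IsSmoothEllipticFamily

lemma AnalyticAt.div_sub_pole_of_zero {u v : ℂ → ℂ} {a : ℂ} (hu : AnalyticAt ℂ u a)
    (hv : AnalyticAt ℂ v a) (hua : u a = 0) (hva : v a = 0) (hda : deriv v a ≠ 0) :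
    HasAnalyticExtensionAt (fun z ↦ u z / v z) a := by
  simpa [hua] using hasAnalyticExtensionAt_div_sub_pole hu hv hva hda

namespace PeriodPair

variable (L : PeriodPair)

lemma analyticAt_weierstrassSigma (z : ℂ) : AnalyticAt ℂ L.weierstrassSigma z :=
  L.differentiable_weierstrassSigma.analyticAt z

lemma analyticAt_weierstrassSigma_sub (b z : ℂ) :
    AnalyticAt ℂ (fun z ↦ L.weierstrassSigma (z - b)) z :=
  (L.analyticAt_weierstrassSigma (z - b)).fun_comp (f := fun z ↦ z - b) (by fun_prop)

lemma analyticAt_prod_weierstrassSigma_sub {ι : Type*} (s : Finset ι) (b : ι → ℂ) (z : ℂ) :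
    AnalyticAt ℂ (fun z ↦ ∏ k ∈ s, L.weierstrassSigma (z - b k)) z :=
  Finset.analyticAt_fun_prod _ fun k _ ↦ L.analyticAt_weierstrassSigma_sub (b k) z

lemma hasDerivAt_weierstrassSigma_sub (b : ℂ) :
    HasDerivAt (fun z ↦ L.weierstrassSigma (z - b)) 1 b := by
  refine HasDerivAt.comp_sub_const b b ?_
  rw [sub_self]
  exact L.hasDerivAt_weierstrassSigma_zero

/-- To check removability of all singularities of a quasi-periodic function, it suffices to look
at the origin, at finitely many given points and at generic points. -/
lemma hasAnalyticExtensionAt_of_quasiperiodic {ι : Type*} [Finite ι] {b : ι → ℂ} {H : ℂ → ℂ}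
    (hadd : ∀ l ∈ L.lattice, ∃ c, ∀ z ∉ L.lattice,
      (∀ k, z - b k ∉ L.lattice) → H (z + l) = H z + c)
    (h0 : HasAnalyticExtensionAt H 0) (hk : ∀ k, HasAnalyticExtensionAt H (b k))
    (hgen : ∀ z ∉ L.lattice, (∀ k, z - b k ∉ L.lattice) → AnalyticAt ℂ H z) (z₀ : ℂ) :
    HasAnalyticExtensionAt H z₀ := by
  have key : ∀ z₁, HasAnalyticExtensionAt H z₁ → z₀ - z₁ ∈ L.lattice →
      HasAnalyticExtensionAt H z₀ := by
    intro z₁ h₁ hl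
    obtain ⟨c, hc⟩ := hadd _ hl
    have := h₁.of_translate (l := z₀ - z₁) (c := c) ?_
    · rwa [add_sub_cancel] at this
    · filter_upwards [L.eventually_generic b z₁] with z hz using hc z hz.1 hz.2
  by_cases hz : z₀ ∈ L.lattice
  · exact key 0 h0 (by simpa using hz)
  · by_cases hz' : ∃ k, z₀ - b k ∈ L.lattice
    · obtain ⟨k, hk'⟩ := hz'
      exact key _ (hk k) hk'
    · exact (hgen z₀ hz (not_exists.1 hz')).hasAnalyticExtensionAt

end PeriodPair

/-! ### The sigma factorization and the vanishing of the defect -/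

/-- The difference between `ḟ / f'` and the Loewner vector field. -/
noncomputable def loewnerDefect {n : ℕ} (L : ℝ → PeriodPair) (f : ℝ → ℂ → ℂ)
    (a : Fin (n + 1) → ℝ → ℂ) (t : ℝ) (z : ℂ) : ℂ :=
  paramDeriv f t z / deriv (f t) z - loewnerField L f a z t

namespace IsSmoothEllipticFamily

variable {n : ℕ} {I : Set ℝ} {L : ℝ → PeriodPair} {f : ℝ → ℂ → ℂ} {a : Fin (n + 1) → ℝ → ℂ}

lemma analyticAt_loewnerField_term {t : ℝ} (k : Fin (n + 1)) {z : ℂ}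
    (hz : z - a k t ∉ (L t).lattice) :
    AnalyticAt ℂ (fun z ↦ critGamma f a k t * ((L t).weierstrassZeta (z - a k t) +
      (L t).weierstrassZeta (a k t) - (L t).eta₁ * z)) z := by
  have : AnalyticAt ℂ (fun z ↦ (L t).weierstrassZeta (z - a k t)) z :=
    ((L t).analyticAt_weierstrassZeta hz).fun_comp (f := fun z ↦ z - a k t) (by fun_prop)
  fun_prop

lemma loewnerField_zero {t : ℝ} : loewnerField L f a 0 t = 0 := by
  simp [loewnerField, PeriodPair.weierstrassZeta_neg]

variable (hf : IsSmoothEllipticFamily n I L f a)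
include hf

lemma analyticAt_deriv {t : ℝ} (ht : t ∈ I) {z : ℂ} (hz : z ∉ (L t).lattice) :
    AnalyticAt ℂ (deriv (f t)) z := (hf.analyticAt ht hz).deriv

/-- The factors of the denominator acquire the extra exponentials `exp(-quasiPeriod l * a_k)`, whose
product is 1 because `∑ a_k = 0`. The remaining multipliers agree, as there are `n + 1` sigma
factors above and below. -/
lemma deriv_mul_sigma_div_add {t : ℝ} (ht : t ∈ I) {l : ℂ} (hl : l ∈ (L t).lattice) {z : ℂ}
    (hz : z ∉ (L t).lattice) (hza : ∀ k, z - a k t ∉ (L t).lattice) :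
    deriv (f t) (z + l) * (L t).weierstrassSigma (z + l) ^ (n + 1) /
        ∏ k, (L t).weierstrassSigma (z + l - a k t) =
      deriv (f t) z * (L t).weierstrassSigma z ^ (n + 1) /
        ∏ k, (L t).weierstrassSigma (z - a k t) := by
  obtain ⟨C, hC, hσ⟩ := (L t).exists_weierstrassSigma_add hl
  set e := Complex.exp ((L t).quasiPeriod l * z) with he
  have hprod : ∏ k, (L t).weierstrassSigma (z + l - a k t) =
      (C * e) ^ (n + 1) * ∏ k, (L t).weierstrassSigma (z - a k t) := by
    have h1 : ∀ k, (L t).weierstrassSigma (z + l - a k t) =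
        C * e * Complex.exp (-((L t).quasiPeriod l * a k t)) *
          (L t).weierstrassSigma (z - a k t) := fun k ↦ by
      rw [add_sub_right_comm, hσ _ (hza k), mul_sub, sub_eq_add_neg, Complex.exp_add]
      ring
    simp only [h1, Finset.prod_mul_distrib, ← Complex.exp_sum, Finset.sum_neg_distrib,
      ← Finset.mul_sum, hf.crit_sum t ht]
    simp [mul_pow]
  rw [hprod, hf.deriv_add_lattice ht hl hz, hσ z hz]
  have : (C * e) ^ (n + 1) ≠ 0 := pow_ne_zero _ (mul_ne_zero hC (Complex.exp_ne_zero _))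
  rw [mul_pow, mul_left_comm, mul_div_mul_left _ _ this]

/-- At 0 the zero of `σ^{n+1}` cancels the pole of `f'`; at `a_k` the zero of `f'` cancels the
simple zero of `σ(z - a_k)`, and the other factors are nonzero by incongruence. -/
lemma hasAnalyticExtensionAt_sigma_quotient {t : ℝ} (ht : t ∈ I) (z₀ : ℂ) :
    HasAnalyticExtensionAt (fun z ↦ deriv (f t) z * (L t).weierstrassSigma z ^ (n + 1) /
      ∏ k, (L t).weierstrassSigma (z - a k t)) z₀ := by
  have hS : ∀ z, AnalyticAt ℂ (fun z ↦ (L t).weierstrassSigma z ^ (n + 1)) z := fun z ↦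
    ((L t).analyticAt_weierstrassSigma z).pow _
  refine (L t).hasAnalyticExtensionAt_of_quasiperiodic (b := fun k ↦ a k t)
    (fun l hl ↦ ⟨0, fun z hz hza ↦ ?_⟩)
    ?_ (fun k ↦ ?_) (fun z hz hza ↦ ?_) z₀
  · rw [add_zero, hf.deriv_mul_sigma_div_add ht hl hz hza]
  · obtain ⟨w, hw, -, hfw⟩ := hf.exists_pow_mul_deriv_eq ht
    refine ⟨fun z ↦ w z * (L t).weierstrassSigmaRegular z ^ (n + 1) /
      ∏ k, (L t).weierstrassSigma (z - a k t), ?_, ?_⟩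
    · refine (hw.mul (((L t).differentiable_weierstrassSigmaRegular.analyticAt 0).pow _)).div
        ((L t).analyticAt_prod_weierstrassSigma_sub _ _ 0)
        (Finset.prod_ne_zero_iff.2 fun k _ ↦ (L t).weierstrassSigma_ne_zero ?_)
      simpa using hf.crit_notMem t ht k
    · filter_upwards [hfw] with z hz
      rw [← hz, PeriodPair.weierstrassSigma_eq, mul_pow]
      ring
  · have hm := hf.crit_notMem t ht k
    have h1 := (hf.analyticAt_deriv ht hm).div_sub_pole_of_zero
      ((L t).analyticAt_weierstrassSigma_sub (a k t) (a k t)) (hf.crit t ht k)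
      (by simp [PeriodPair.weierstrassSigma_zero])
      (by rw [((L t).hasDerivAt_weierstrassSigma_sub _).deriv]; exact one_ne_zero)
    have h2 : AnalyticAt ℂ (fun z ↦ (L t).weierstrassSigma z ^ (n + 1) /
        ∏ j ∈ Finset.univ.erase k, (L t).weierstrassSigma (z - a j t)) (a k t) := by
      refine (hS _).div ((L t).analyticAt_prod_weierstrassSigma_sub _ _ _)
        (Finset.prod_ne_zero_iff.2 fun j hj ↦ (L t).weierstrassSigma_ne_zero ?_)
      exact hf.crit_incongruent t ht _ _ (Finset.ne_of_mem_erase hj).symm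
    refine (h1.mul h2.hasAnalyticExtensionAt).congr (.of_eq (funext fun z ↦ ?_))
    rw [← Finset.mul_prod_erase _ _ (Finset.mem_univ k)]
    rw [div_mul_div_comm]
  · exact ((hf.analyticAt_deriv ht hz).mul (hS z)).div
      ((L t).analyticAt_prod_weierstrassSigma_sub _ _ _)
      (Finset.prod_ne_zero_iff.2 fun k _ ↦ (L t).weierstrassSigma_ne_zero (hza k))

lemma exists_deriv_mul_sigma_eq {t : ℝ} (ht : t ∈ I) :
    ∃ c : ℂ, c ≠ 0 ∧ ∀ z ∉ (L t).lattice, deriv (f t) z * (L t).weierstrassSigma z ^ (n + 1) =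
      c * ∏ k, (L t).weierstrassSigma (z - a k t) := by
  have hper : ∀ l ∈ (L t).lattice, ∀ z₀, ∀ᶠ z in 𝓝[≠] z₀,
      deriv (f t) (z + l) * (L t).weierstrassSigma (z + l) ^ (n + 1) /
        ∏ k, (L t).weierstrassSigma (z + l - a k t) =
      deriv (f t) z * (L t).weierstrassSigma z ^ (n + 1) /
        ∏ k, (L t).weierstrassSigma (z - a k t) + 0 := fun l hl z₀ ↦ by
    filter_upwards [(L t).eventually_generic (fun k ↦ a k t) z₀] with z hz
    rw [add_zero, hf.deriv_mul_sigma_div_add ht hl hz.1 hz.2]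
  obtain ⟨α, c, hα, -, hc⟩ := (L t).exists_affine_extension
    (hf.hasAnalyticExtensionAt_sigma_quotient ht) (hper _ (L t).ω₁_mem_lattice)
    (hper _ (L t).ω₂_mem_lattice)
  rw [hf.period_one t ht, mul_one] at hα
  have hprod : ∀ z, (∀ k, z - a k t ∉ (L t).lattice) →
      ∏ k, (L t).weierstrassSigma (z - a k t) ≠ 0 := fun z hz ↦
    Finset.prod_ne_zero_iff.2 fun k _ ↦ (L t).weierstrassSigma_ne_zero (hz k)
  refine ⟨c, ?_, fun z hz ↦ ?_⟩
  · obtain ⟨z, hz, hgen⟩ := ((hc 0).and ((L t).eventually_generic (fun k ↦ a k t) 0)).exists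
    simp only [hα, zero_mul, add_zero] at hz
    rw [← hz]
    exact div_ne_zero (mul_ne_zero (hf.deriv_ne_zero ht hgen.1 hgen.2)
      (pow_ne_zero _ ((L t).weierstrassSigma_ne_zero hgen.1))) (hprod z hgen.2)
  · refine eq_of_eventuallyEq_punctured_nhds
      (G := fun z ↦ deriv (f t) z * (L t).weierstrassSigma z ^ (n + 1))
      (K := fun z ↦ c * ∏ k, (L t).weierstrassSigma (z - a k t))
      ((hf.analyticAt_deriv ht hz).continuousAt.mul
        (((L t).analyticAt_weierstrassSigma z).continuousAt.pow _))
      (continuousAt_const.mul ((L t).analyticAt_prod_weierstrassSigma_sub _ _ z).continuousAt) ?_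
    filter_upwards [hc z, (L t).eventually_generic (fun k ↦ a k t) z] with w hw hgen
    simp only [hα, zero_mul, add_zero] at hw
    rwa [div_eq_iff (hprod w hgen.2)] at hw

/-- Differentiate the factorization at `a_k`: since `f'(a_k) = 0`, `σ(0) = 0` and `σ'(0) = 1`, one
term of the product rule survives on each side. -/
lemma critD_mul_sigma_eq {t : ℝ} (ht : t ∈ I) {c : ℂ}
    (hc : ∀ z ∉ (L t).lattice, deriv (f t) z * (L t).weierstrassSigma z ^ (n + 1) =
      c * ∏ k, (L t).weierstrassSigma (z - a k t)) (k : Fin (n + 1)) :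
    critD f a k t * (L t).weierstrassSigma (a k t) ^ (n + 1) =
      c * ∏ j ∈ Finset.univ.erase k, (L t).weierstrassSigma (a k t - a j t) := by
  have hm := hf.crit_notMem t ht k
  have h1 := (hf.analyticAt_deriv ht hm).differentiableAt.hasDerivAt.mul
    (((L t).analyticAt_weierstrassSigma (a k t)).pow (n + 1)).differentiableAt.hasDerivAt
  have h2 := (((L t).hasDerivAt_weierstrassSigma_sub (a k t)).mul
    ((L t).analyticAt_prod_weierstrassSigma_sub (Finset.univ.erase k) (fun j ↦ a j t)
      (a k t)).differentiableAt.hasDerivAt).const_mul c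
  have he : (deriv (f t) * (L t).weierstrassSigma ^ (n + 1)) =ᶠ[𝓝 (a k t)] fun z ↦
      c * ((fun z ↦ (L t).weierstrassSigma (z - a k t)) * fun z ↦
        ∏ j ∈ Finset.univ.erase k, (L t).weierstrassSigma (z - a j t)) z := by
    filter_upwards [(L t).isOpen_compl_lattice.mem_nhds hm] with z hz
    refine (hc z hz).trans ?_
    rw [Pi.mul_apply, Finset.mul_prod_erase _ (fun j ↦ (L t).weierstrassSigma (z - a j t))
      (Finset.mem_univ k)]
  have := h1.unique (h2.congr_of_eventuallyEq he)
  simpa [critD, hf.crit t ht k, PeriodPair.weierstrassSigma_zero] using! this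

/-- Since `γ_0 = 0`, the index 0 may be included, so that all critical points are treated alike. -/
lemma loewnerField_eq_sum {t : ℝ} (ht : t ∈ I) (z : ℂ) :
    loewnerField L f a z t = ∑ k, critGamma f a k t *
      ((L t).weierstrassZeta (z - a k t) + (L t).weierstrassZeta (a k t) - (L t).eta₁ * z) := by
  rw [Fin.sum_univ_succ, hf.critGamma_zero ht, zero_mul, zero_add, loewnerField]

lemma loewnerDefect_add {t : ℝ} (ht : t ∈ I) (m k : ℤ) {z : ℂ} (hz : z ∉ (L t).lattice)
    (hza : ∀ k, z - a k t ∉ (L t).lattice) :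
    loewnerDefect L f a t (z + (m * (L t).ω₁ + k * (L t).ω₂)) = loewnerDefect L f a t z +
      (-(k * deriv (fun s ↦ (L s).ω₂) t) - (∑ j : Fin n, critGamma f a j.succ t) *
        ((L t).quasiPeriod (m * (L t).ω₁ + k * (L t).ω₂) -
          (L t).eta₁ * (m * (L t).ω₁ + k * (L t).ω₂))) := by
  have hl : m * (L t).ω₁ + k * (L t).ω₂ ∈ (L t).lattice := PeriodPair.mem_lattice.2 ⟨m, k, rfl⟩
  rw [loewnerDefect, hf.paramDeriv_add_lattice ht m k hz, hf.deriv_add_lattice ht hl hz,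
    loewnerDefect, loewnerField, loewnerField, Finset.sum_mul, sub_div,
    mul_div_cancel_right₀ _ (hf.deriv_ne_zero ht hz hza)]
  have : ∀ j : Fin n, critGamma f a j.succ t *
      ((L t).weierstrassZeta (z + (m * (L t).ω₁ + k * (L t).ω₂) - a j.succ t) +
        (L t).weierstrassZeta (a j.succ t) -
        (L t).eta₁ * (z + (m * (L t).ω₁ + k * (L t).ω₂))) =
      critGamma f a j.succ t * ((L t).weierstrassZeta (z - a j.succ t) +
        (L t).weierstrassZeta (a j.succ t) - (L t).eta₁ * z) +
      critGamma f a j.succ t * ((L t).quasiPeriod (m * (L t).ω₁ + k * (L t).ω₂) -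
          (L t).eta₁ * (m * (L t).ω₁ + k * (L t).ω₂)) := fun j ↦ by
    rw [add_sub_right_comm z, (L t).weierstrassZeta_add hl (hza j.succ)]
    ring
  simp only [this, Finset.sum_add_distrib]
  ring

lemma analyticAt_loewnerField {t : ℝ} (ht : t ∈ I) {z : ℂ}
    (hz : ∀ k, z - a k t ∉ (L t).lattice) : AnalyticAt ℂ (fun z ↦ loewnerField L f a z t) z := by
  simp only [hf.loewnerField_eq_sum ht]
  exact Finset.analyticAt_fun_sum _ fun k _ ↦ analyticAt_loewnerField_term k (hz k)

lemma analyticAt_loewnerDefect {t : ℝ} (ht : t ∈ I) {z : ℂ} (hz : z ∉ (L t).lattice)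
    (hza : ∀ k, z - a k t ∉ (L t).lattice) : AnalyticAt ℂ (loewnerDefect L f a t) z :=
  ((hf.analyticAt_paramDeriv ht hz).div (hf.analyticAt_deriv ht hz)
    (hf.deriv_ne_zero ht hz hza)).sub (hf.analyticAt_loewnerField ht hza)

/-- Near 0 one has `ḟ/f' = z v / w` with `w(0) ≠ 0`, which vanishes at 0. This zero later fixes the
additive constant. -/
lemma exists_loewnerDefect_extension_zero {t : ℝ} (ht : t ∈ I) :
    ∃ g, AnalyticAt ℂ g 0 ∧ g 0 = 0 ∧ loewnerDefect L f a t =ᶠ[𝓝[≠] 0] g := by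
  obtain ⟨w, hw, hw0, hfw⟩ := hf.exists_pow_mul_deriv_eq ht
  obtain ⟨v, hv, hfv⟩ := hf.hasAnalyticExtensionAt_pow_mul_paramDeriv ht
  refine ⟨fun z ↦ z * v z / w z - loewnerField L f a z t, ?_, ?_, ?_⟩
  · refine ((analyticAt_id.mul hv).div hw hw0).sub (hf.analyticAt_loewnerField ht fun k ↦ ?_)
    simpa using hf.crit_notMem t ht k
  · simp [loewnerField_zero]
  · filter_upwards [hfw, hfv, self_mem_nhdsWithin] with z hzw hzv hz0
    have hz0' : z ≠ 0 := hz0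
    rw [loewnerDefect, ← hzw, ← hzv, ← mul_assoc, ← pow_succ',
      mul_div_mul_left _ _ (pow_ne_zero _ hz0')]

/-- Both `ḟ/f'` and the field have principal part `γ_k / (z - a_k)`. -/
lemma hasAnalyticExtensionAt_loewnerDefect_crit {t : ℝ} (ht : t ∈ I) (k : Fin (n + 1)) :
    HasAnalyticExtensionAt (loewnerDefect L f a t) (a k t) := by
  have hm := hf.crit_notMem t ht k
  have h1 := hasAnalyticExtensionAt_div_sub_pole (hf.analyticAt_paramDeriv ht hm)
    (hf.analyticAt_deriv ht hm) (hf.crit t ht k) (hf.crit_simple t ht k)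
  rw [← hf.critGamma_eq ht] at h1
  have h2 : AnalyticAt ℂ (fun z ↦ ∑ j ∈ Finset.univ.erase k, critGamma f a j t *
      ((L t).weierstrassZeta (z - a j t) + (L t).weierstrassZeta (a j t) - (L t).eta₁ * z))
      (a k t) :=
    Finset.analyticAt_fun_sum _ fun j hj ↦ analyticAt_loewnerField_term j
      (hf.crit_incongruent t ht _ _ (Finset.ne_of_mem_erase hj).symm)
  have h3 : AnalyticAt ℂ (fun z ↦ critGamma f a k t * ((L t).weierstrassZetaRegular (z - a k t) +
      (L t).weierstrassZeta (a k t) - (L t).eta₁ * z)) (a k t) := by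
    have : AnalyticAt ℂ (fun z ↦ (L t).weierstrassZetaRegular (z - a k t)) (a k t) := by
      refine AnalyticAt.fun_comp (f := fun z ↦ z - a k t) ?_ (by fun_prop)
      rw [sub_self]
      exact (L t).analyticAt_weierstrassZetaRegular_zero
    fun_prop
  refine (h1.sub (h2.add h3).hasAnalyticExtensionAt).congr (.of_eq (funext fun z ↦ ?_))
  rw [loewnerDefect, hf.loewnerField_eq_sum ht, ← Finset.add_sum_erase _ _ (Finset.mem_univ k),
    PeriodPair.weierstrassZeta_eq _ (z - a k t), Pi.add_apply]
  ring

lemma hasAnalyticExtensionAt_loewnerDefect {t : ℝ} (ht : t ∈ I) (z₀ : ℂ) :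
    HasAnalyticExtensionAt (loewnerDefect L f a t) z₀ := by
  refine (L t).hasAnalyticExtensionAt_of_quasiperiodic (b := fun k ↦ a k t) (fun l hl ↦ ?_) ?_
    (hf.hasAnalyticExtensionAt_loewnerDefect_crit ht)
    (fun z hz hza ↦ hf.analyticAt_loewnerDefect ht hz hza) z₀
  · obtain ⟨m, k, rfl⟩ := PeriodPair.mem_lattice.1 hl
    exact ⟨_, fun z hz hza ↦ hf.loewnerDefect_add ht m k hz hza⟩
  · obtain ⟨g, hg, -, h⟩ := hf.exists_loewnerDefect_extension_zero ht
    exact ⟨g, hg, h⟩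

lemma loewnerDefect_eq_zero {t : ℝ} (ht : t ∈ I) :
    deriv (fun s ↦ (L s).ω₂) t =
        2 * Real.pi * Complex.I * ∑ j : Fin n, critGamma f a j.succ t ∧
      ∀ z, loewnerDefect L f a t =ᶠ[𝓝[≠] z] fun _ ↦ 0 := by
  have h₁ : ∀ z₀, ∀ᶠ z in 𝓝[≠] z₀,
      loewnerDefect L f a t (z + (L t).ω₁) = loewnerDefect L f a t z + 0 := fun z₀ ↦ by
    filter_upwards [(L t).eventually_generic (fun k ↦ a k t) z₀] with z hz
    have := hf.loewnerDefect_add ht 1 0 hz.1 hz.2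
    simp only [Int.cast_zero, zero_mul, neg_zero, Int.cast_one, one_mul, add_zero,
      PeriodPair.quasiPeriod_ω₁] at this
    rw [this, hf.period_one t ht]
    ring
  have h₂ : ∀ z₀, ∀ᶠ z in 𝓝[≠] z₀, loewnerDefect L f a t (z + (L t).ω₂) =
      loewnerDefect L f a t z + (2 * Real.pi * Complex.I * ∑ j : Fin n, critGamma f a j.succ t -
        deriv (fun s ↦ (L s).ω₂) t) := fun z₀ ↦ by
    filter_upwards [(L t).eventually_generic (fun k ↦ a k t) z₀] with z hz
    have := hf.loewnerDefect_add ht 0 1 hz.1 hz.2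
    simp only [Int.cast_zero, zero_mul, zero_add, Int.cast_one, one_mul] at this
    rw [this]
    -- Legendre's relation evaluates the zeta part of the increment over `ω₂`.
    linear_combination (∑ j : Fin n, critGamma f a j.succ t) *
      (L t).legendre_relation (hf.period_one t ht) (hf.period_two_im_pos t ht)
  obtain ⟨α, β, hα, hα₂, h⟩ := (L t).exists_affine_extension
    (hf.hasAnalyticExtensionAt_loewnerDefect ht) h₁ h₂
  -- The increment over `ω₁` is 0, so the slope vanishes; then the increment over `ω₂` must vanish
  -- as well, and this is the equation for the period.
  rw [hf.period_one t ht, mul_one] at hα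
  rw [hα, zero_mul] at hα₂
  have hβ : β = 0 := by
    obtain ⟨g, hg, hg0, hgz⟩ := hf.exists_loewnerDefect_extension_zero ht
    have := eq_of_eventuallyEq_punctured_nhds hg.continuousAt
      (by fun_prop : ContinuousAt (fun z ↦ β + α * z) 0) (hgz.symm.trans (h 0))
    simpa [hg0] using this.symm
  refine ⟨by linear_combination hα₂, fun z ↦ ?_⟩
  simpa [hα, hβ] using h z

lemma notMem_of_deriv_ne_zero {t : ℝ} (ht : t ∈ I) {z : ℂ} (hd : deriv (f t) z ≠ 0)
    (k : Fin (n + 1)) : z - a k t ∉ (L t).lattice := fun h ↦ hd (by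
  have := hf.deriv_add_lattice ht h (hf.crit_notMem t ht k)
  rwa [add_sub_cancel, hf.crit t ht k] at this)

end IsSmoothEllipticFamily

theorem mainTheorem1 (n : ℕ) (I : Set ℝ) (L : ℝ → PeriodPair) (f : ℝ → ℂ → ℂ)
    (a : Fin (n + 1) → ℝ → ℂ) (hf : IsSmoothEllipticFamily n I L f a) :
    (∀ t ∈ I, ∀ z, z ∉ (L t).lattice → deriv (f t) z ≠ 0 →
      deriv (fun s => f s z) t / deriv (f t) z = loewnerField L f a z t) ∧
    (∃ c : ℝ → ℂ, ∀ t ∈ I, c t ≠ 0 ∧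
      (∀ z, z ∉ (L t).lattice → deriv (f t) z =
        c t * (∏ k, (L t).weierstrassSigma (z - a k t)) / (L t).weierstrassSigma z ^ (n + 1)) ∧
      (∀ k, critD f a k t =
        c t * (∏ j ∈ Finset.univ.erase k, (L t).weierstrassSigma (a k t - a j t)) /
          (L t).weierstrassSigma (a k t) ^ (n + 1))) ∧
    (∀ t ∈ I, HasDerivAt (fun s => (L s).ω₂)
      (2 * (Real.pi : ℂ) * Complex.I * ∑ j : Fin n, critGamma f a j.succ t) t) := by
  refine ⟨fun t ht z hz hd ↦ ?_, ?_, fun t ht ↦ ?_⟩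
  · have hza := hf.notMem_of_deriv_ne_zero ht hd
    -- The defect is known to vanish only on punctured neighbourhoods; continuity at the noncritical
    -- point `z` extends this to `z` itself.
    exact sub_eq_zero.1 (eq_of_eventuallyEq_punctured_nhds
      (hf.analyticAt_loewnerDefect ht hz hza).continuousAt continuousAt_const
      ((hf.loewnerDefect_eq_zero ht).2 z))
  · choose! c hc0 hc using fun t ht ↦ hf.exists_deriv_mul_sigma_eq (t := t) ht
    refine ⟨c, fun t ht ↦ ⟨hc0 t ht, fun z hz ↦ ?_, fun k ↦ ?_⟩⟩
    · rw [eq_div_iff (pow_ne_zero _ ((L t).weierstrassSigma_ne_zero hz)), hc t ht z hz]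
    · rw [eq_div_iff (pow_ne_zero _ ((L t).weierstrassSigma_ne_zero (hf.crit_notMem t ht k))),
        hf.critD_mul_sigma_eq ht (hc t ht) k]
  · rw [← (hf.loewnerDefect_eq_zero ht).1]
    exact hf.hasDerivAt_period ht
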